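/- A variety of lattices is the class of all lattices satisfying a given set of lattice identities; it is non-distributive if it contains a non-distributive lattice. An algebra is a set with a family of finitary operations. For a lattice or an algebra $A$, let $\operatorname{Con} A$ be its congruence lattice, and for a lattice $F$ let $\operatorname{Con_c} F$ be the join-semilattice with zero of all compact (that is, finitely generated) congruences of $F$. The algebra $A$ has almost permutable congruences if $\boldsymbol a\vee\boldsymbol b=\boldsymbol a\boldsymbol b\cup\boldsymbol b\boldsymbol a$ for all $\boldsymbol a,\boldsymbol b\in\operatorname{Con} A$, where $\boldsymbol a\boldsymbol b$ is the composition of relations (this holds in particular if the congruences of $A$ permute). For a join-semilattice $S$ with zero and a set $Y$, a V-distance of type $3/2$ is a map $\delta\colon Y\times Y\to S$ such that, for all $x,y,z\in Y$, $\delta(x,x)=0$, $\delta(x,y)=\delta(y,x)$, $\delta(x,z)\le\delta(x,y)\vee\delta(y,z)$, and such that whenever $\delta(x,y)\le \boldsymbol a\vee \boldsymbol b$ with $\boldsymbol a,\boldsymbol b\in S$, there is $z\in Y$ with either ($\delta(x,z)\le \boldsymbol a$ and $\delta(z,y)\le \boldsymbol b$) or ($\delta(x,z)\le \boldsymbol b$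 and $\delta(z,y)\le \boldsymbol a$). Its range join-generates $S$ if every element of $S$ is a join of finitely many values of $\delta$. **Theorem.** Let $\mathcal V$ be a non-distributive variety of lattices. (1) Let $F$ be a free lattice, or a free bounded lattice, in $\mathcal V$ on a set $X$ of generators with $|X|\ge\aleph_2$. Then: * there is no V-distance of type $3/2$ whose range join-generates $\operatorname{Con_c} F$; * there is no algebra $A$ with almost permutable congruences such that $\operatorname{Con} F\cong\operatorname{Con} A$; * $D=\operatorname{Con} F$ is a distributive algebraic lattice with exactly $|X|$ compact elements (hence exactly $\aleph_2$ of them if $|X|=\aleph_2$), and $D$ is not isomorphic to the submodule lattice of any module over any ring, nor to the lattice of normal subgroups of any group, nor to the lattice of $\ell$-ideals (convex normal $\ell$-subgroups) of any lattice-ordered group. (2) Consequently there is a distributive algebraic lattice with exactly $\aleph_2$ compact elements that is not isomorphic to the congruence lattice of any algebra with almost permutable congruences, which answers negatively Schmidt's problem whether every distributive algebraic lattice is isomorphic to the congruence lattice of an algebra with permutable congruences. -/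

import Mathlib

open scoped Cardinal

universe u v w

/-! ### Lattice varieties and free lattices -/

/-- Lattice terms in countably many variables. -/
inductive LatticeTerm : Type where
  | var : ℕ → LatticeTerm
  | sup : LatticeTerm → LatticeTerm → LatticeTerm
  | inf : LatticeTerm → LatticeTerm → LatticeTerm

/-- The value of a lattice term in a lattice under an assignment of the variables. -/
def LatticeTerm.eval {L : Type u} [Lattice L] (f : ℕ → L) : LatticeTerm → L
  | .var n => f n
  | .sup s t => s.eval f ⊔ t.eval f
  | .inf s t => s.eval f ⊓ t.eval f

/-- A variety of lattices, given by a set of lattice identities `s = t`. -/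
structure LatticeVariety : Type where
  identities : Set (LatticeTerm × LatticeTerm)

/-- The lattice `L` belongs to the variety `V`: it satisfies all the identities defining `V`. -/
def LatticeVariety.Mem (V : LatticeVariety) (L : Type u) [Lattice L] : Prop :=
  ∀ p ∈ V.identities, ∀ f : ℕ → L, p.1.eval f = p.2.eval f

/-- The lattice `L` is distributive. -/
def IsDistribLattice (L : Type u) [Lattice L] : Prop :=
  ∀ a b c : L, a ⊓ (b ⊔ c) = (a ⊓ b) ⊔ (a ⊓ c)

/-- The variety `V` is non-distributive: some member of `V` is not distributive. -/
def LatticeVariety.IsNonDistributive (V : LatticeVariety) : Prop :=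
  ∃ (M : Type w) (_ : Lattice M), V.Mem M ∧ ¬ IsDistribLattice M

/-- `F`, with `ι : X → F`, is a free lattice on the set of generators `X` in the variety `V`. -/
def LatticeVariety.IsFree (V : LatticeVariety) {X F : Type u} [Lattice F] (ι : X → F) : Prop :=
  V.Mem F ∧ ∀ (L : Type u) [Lattice L], V.Mem L → ∀ f : X → L,
    ∃! g : LatticeHom F L, ∀ x, g (ι x) = f x

/-- `F`, with `ι : X → F`, is a free bounded lattice on the set of generators `X` in the
variety `V`; the bounds are constants, preserved by the homomorphisms. -/
def LatticeVariety.IsFreeBounded (V : LatticeVariety) {X F : Type u} [Lattice F] (ι : X → F) :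
    Prop :=
  ∃ _ : BoundedOrder F, V.Mem F ∧
    ∀ (L : Type u) [Lattice L] [BoundedOrder L], V.Mem L → ∀ f : X → L,
      ∃! g : BoundedLatticeHom F L, ∀ x, g (ι x) = f x

/-! ### The congruence lattice of a lattice -/

namespace LatticeCon

variable {α : Type u} [Lattice α]

theorem r_injective : Function.Injective (fun c : LatticeCon α => c.r) := by
  rintro ⟨⟨r, _⟩, _, _⟩ ⟨⟨s, _⟩, _, _⟩ h
  cases h
  rfl

/-- Congruences are ordered by inclusion. -/
instance instPartialOrder : PartialOrder (LatticeCon α) where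
  le c d := ∀ ⦃x y⦄, c.r x y → d.r x y
  le_refl _ _ _ h := h
  le_trans _ _ _ h₁ h₂ _ _ h := h₂ (h₁ h)
  le_antisymm _ _ h₁ h₂ := r_injective (funext₂ fun _ _ => propext ⟨fun h => h₁ h, fun h => h₂ h⟩)

/-- Infima of congruences are intersections. -/
instance instInfSet : InfSet (LatticeCon α) where
  sInf C :=
    { r := fun x y => ∀ c ∈ C, c.r x y
      iseqv :=
        ⟨fun x c _ => c.iseqv.refl x, fun h c hc => c.iseqv.symm (h c hc),
          fun h₁ h₂ c hc => c.iseqv.trans (h₁ c hc) (h₂ c hc)⟩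
      inf := fun h₁ h₂ c hc => c.inf (h₁ c hc) (h₂ c hc)
      sup := fun h₁ h₂ c hc => c.sup (h₁ c hc) (h₂ c hc) }

/-- The congruence lattice `Con α` of a lattice `α`. -/
instance instCompleteLattice : CompleteLattice (LatticeCon α) :=
  completeLatticeOfInf _ fun _ =>
    ⟨fun _ hc _ _ h => h _ hc, fun _ hd _ _ h _ hc => hd hc h⟩

end LatticeCon

/-! ### Compact elements -/

/-- The set of compact elements of a complete lattice. -/
abbrev CompactElements (D : Type u) [CompleteLattice D] : Type u :=
  {c : D // IsCompactElement c}

namespace CompactElements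

variable {D : Type u} [CompleteLattice D]

/-- The compact elements form a join-semilattice, with the join of `D`. -/
instance instSemilatticeSup : SemilatticeSup (CompactElements D) :=
  Subtype.semilatticeSup fun _ _ ha hb s u hs hd hu h => by
    obtain ⟨p, hp, hap⟩ := ha s u hs hd hu (le_sup_left.trans h)
    obtain ⟨q, hq, hbq⟩ := hb s u hs hd hu (le_sup_right.trans h)
    obtain ⟨r, hr, hpr, hqr⟩ := hd p hp q hq
    exact ⟨r, hr, sup_le (hap.trans hpr) (hbq.trans hqr)⟩

/-- The zero of the join-semilattice of compact elements is the zero of `D`. -/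
instance instOrderBot : OrderBot (CompactElements D) :=
  Subtype.orderBot fun _ _ hs _ _ _ => hs.imp fun _ hx => ⟨hx, bot_le⟩

end CompactElements

/-- The join-semilattice `Con_c L` of all compact (finitely generated) congruences of a
lattice `L`. -/
abbrev Conc (L : Type u) [Lattice L] : Type u := CompactElements (LatticeCon L)

/-! ### Semilattice-valued distances -/

/-- `δ` is an `S`-valued distance on `Y`. -/
structure IsDistance {S : Type u} [SemilatticeSup S] [OrderBot S] {Y : Type v}
    (δ : Y → Y → S) : Prop where
  self : ∀ x, δ x x = ⊥
  symm : ∀ x y, δ x y = δ y x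
  triangle : ∀ x y z, δ x z ≤ δ x y ⊔ δ y z

/-- `δ` is a V-distance of type `3/2`. -/
structure IsVDistanceThreeHalves {S : Type u} [SemilatticeSup S] [OrderBot S] {Y : Type v}
    (δ : Y → Y → S) : Prop extends IsDistance δ where
  v_condition : ∀ (x y : Y) (a b : S), δ x y ≤ a ⊔ b →
    ∃ z, (δ x z ≤ a ∧ δ z y ≤ b) ∨ (δ x z ≤ b ∧ δ z y ≤ a)

/-- The range of `δ` join-generates `S`: every element of `S` is the join of finitely many
values of `δ`. -/
def RangeJoinGenerates {S : Type u} [SemilatticeSup S] [OrderBot S] {Y : Type v}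
    (δ : Y → Y → S) : Prop :=
  ∀ s : S, ∃ t : Finset (Y × Y), s = t.sup fun p => δ p.1 p.2

/-! ### Algebras and their congruences -/

/-- An algebra structure, in the sense of universal algebra, on the set `A`: a family of
finitary operations on `A`. -/
structure AlgebraStructure (A : Type u) : Type (max u (v + 1)) where
  Op : Type v
  arity : Op → ℕ
  op : ∀ i : Op, (Fin (arity i) → A) → A

/-- A congruence of an algebra: an equivalence relation compatible with all operations. -/
structure AlgebraCon {A : Type u} (𝔸 : AlgebraStructure.{u, v} A) extends Setoid A where
  compat : ∀ (i : 𝔸.Op) (x y : Fin (𝔸.arity i) → A),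
    (∀ k, r (x k) (y k)) → r (𝔸.op i x) (𝔸.op i y)

namespace AlgebraCon

variable {A : Type u} {𝔸 : AlgebraStructure.{u, v} A}

theorem r_injective : Function.Injective (fun c : AlgebraCon 𝔸 => c.r) := by
  rintro ⟨⟨r, _⟩, _⟩ ⟨⟨s, _⟩, _⟩ h
  cases h
  rfl

/-- Congruences are ordered by inclusion. -/
instance instPartialOrder : PartialOrder (AlgebraCon 𝔸) where
  le c d := ∀ ⦃x y⦄, c.r x y → d.r x y
  le_refl _ _ _ h := h
  le_trans _ _ _ h₁ h₂ _ _ h := h₂ (h₁ h)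
  le_antisymm _ _ h₁ h₂ := r_injective (funext₂ fun _ _ => propext ⟨fun h => h₁ h, fun h => h₂ h⟩)

/-- Infima of congruences are intersections. -/
instance instInfSet : InfSet (AlgebraCon 𝔸) where
  sInf C :=
    { r := fun x y => ∀ c ∈ C, c.r x y
      iseqv :=
        ⟨fun x c _ => c.iseqv.refl x, fun h c hc => c.iseqv.symm (h c hc),
          fun h₁ h₂ c hc => c.iseqv.trans (h₁ c hc) (h₂ c hc)⟩
      compat := fun i x y h c hc => c.compat i x y fun k => h k c hc }

/-- The congruence lattice `Con 𝔸` of an algebra `𝔸`. -/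
instance instCompleteLattice : CompleteLattice (AlgebraCon 𝔸) :=
  completeLatticeOfInf _ fun _ =>
    ⟨fun _ hc _ _ h => h _ hc, fun _ hd _ _ h _ hc => hd hc h⟩

end AlgebraCon

/-- The algebra `𝔸` has almost permutable congruences: `a ∨ b = ab ∪ ba` for all congruences
`a` and `b`, where `ab` is the composition of relations. -/
def AlgebraStructure.HasAlmostPermutableCongruences {A : Type u}
    (𝔸 : AlgebraStructure.{u, v} A) : Prop :=
  ∀ (a b : AlgebraCon 𝔸) (x y : A),
    (a ⊔ b).r x y ↔ (∃ z, a.r x z ∧ b.r z y) ∨ (∃ z, b.r x z ∧ a.r z y)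

/-! ### Lattice-ordered groups -/

/-- An `ℓ`-ideal of a lattice-ordered group: a convex normal subgroup that is a sublattice. -/
structure IsLIdeal {G : Type u} [Group G] [Lattice G] (N : Subgroup G) : Prop where
  normal : N.Normal
  convex : (N : Set G).OrdConnected
  sup_mem : ∀ ⦃a b⦄, a ∈ N → b ∈ N → a ⊔ b ∈ N
  inf_mem : ∀ ⦃a b⦄, a ∈ N → b ∈ N → a ⊓ b ∈ N

/-! All the negative statements reduce to the one on V-distances. In each excluded lattice
(congruences, submodules, normal subgroups, `ℓ`-ideals) the members act as equivalence relations on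
a set, directed joins are unions, and the join of two members is the union of their two
compositions. Sending a pair to the least member relating it is then a V-distance of type `3/2`
whose range join-generates the compact elements, and it can be carried along an isomorphism with
`Con F`.

Such a distance forces a uniform refinement. Given ℵ₂ decompositions `e ≤ a i ⊔ b i`, choose
intermediate points `z i` for them; on ℵ₂ indices the choices follow the same pattern, and the
distances `c i j` between `z i` and `z j` satisfy the inequalities of `IsUniformRefinement`.

In `F` take generators `u`, `v`, `x i`, `y i` and put `e = θ(u, v)`, `a i = θ(u, x i) ⊔ θ(y i, v)`,
`b i = θ(x i, y i)`. A non-distributive variety has a bounded member `L` in which some `y` has two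
complements `x ≰ z`. Each `c i j` depends on finitely many indices, so Kuratowski's theorem gives
`i, j, k` such that each of the three congruences `c` ignores the third index. Send `u`, `v` to the
bounds and the pairs at `i, j, k` to `(x, ⊤)`, `(⊥, y)`, `(z, ⊤)`, all other pairs to `(⊥, ⊤)`. The
Boolean squares `{⊥, x, y, ⊤}` and `{⊥, z, y, ⊤}` show that `c i j` and `c j k` are collapsed, hence
so is `c i k`. Now `j` may be forgotten; every value is above `x` or below `z`, and the resulting
map to `{⊥, ⊤}` collapses `c i k`, `b i` and `a k`, hence `e`, although it separates `u` from `v`.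

Distributivity of `Con F` comes from the majority term, and the cardinality from counting finite
joins of principal congruences. -/

/-! ### Representations of ordered sets by equivalence relations -/

/-- An order-embedding of `P` into the equivalence relations on `Y` that has least elements
containing a given pair and in which directed joins are unions. -/
structure IsRelRep {P : Type u} [PartialOrder P] {Y : Type v} (r : P → Y → Y → Prop) : Prop where
  equiv : ∀ a, Equivalence (r a)
  le : ∀ a b, (∀ x y, r a x y → r b x y) → a ≤ b
  principal : ∀ x y, ∃ c, ∀ d, r d x y ↔ c ≤ d
  directed : ∀ C : Set P, C.Nonempty → DirectedOn (· ≤ ·) C →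
    ∃ s, (∀ c ∈ C, c ≤ s) ∧ ∀ x y, r s x y → ∃ c ∈ C, r c x y

/-- Joins of pairs are unions of the two compositions. -/
def IsAlmostPermutable {P : Type u} [PartialOrder P] {Y : Type v} (r : P → Y → Y → Prop) : Prop :=
  ∀ a b, ∃ s, a ≤ s ∧ b ≤ s ∧ ∀ x y, r s x y →
    (∃ z, r a x z ∧ r b z y) ∨ (∃ z, r b x z ∧ r a z y)

theorem IsAlmostPermutable.comp {P : Type u} [PartialOrder P] {Y : Type v} {D : Type w}
    [PartialOrder D] {r : P → Y → Y → Prop} (h : IsAlmostPermutable r) (e : D ≃o P) :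
    IsAlmostPermutable fun d => r (e d) := by
  intro a b
  obtain ⟨s, h1, h2, h3⟩ := h (e a) (e b)
  refine ⟨e.symm s, by simpa [e.le_symm_apply] using h1, by simpa [e.le_symm_apply] using h2, ?_⟩
  simpa using h3

namespace IsRelRep

theorem comp {P : Type u} [PartialOrder P] {Y : Type v} {D : Type w}
    [PartialOrder D] {r : P → Y → Y → Prop} (h : IsRelRep r) (e : D ≃o P) :
    IsRelRep fun d => r (e d) where
  equiv a := h.equiv _
  le a b hab := e.le_iff_le.1 (h.le _ _ hab)
  principal x y := by
    obtain ⟨c, hc⟩ := h.principal x y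
    exact ⟨e.symm c, fun d => by rw [hc, e.symm_apply_le]⟩
  directed C hC hd := by
    obtain ⟨s, h1, h2⟩ := h.directed (e '' C) (hC.image _)
      (by
        rintro _ ⟨a, ha, rfl⟩ _ ⟨b, hb, rfl⟩
        obtain ⟨c, hc, h1, h2⟩ := hd a ha b hb
        exact ⟨e c, ⟨c, hc, rfl⟩, e.monotone h1, e.monotone h2⟩)
    refine ⟨e.symm s, fun c hc => by simpa [e.le_symm_apply] using h1 _ ⟨c, hc, rfl⟩, ?_⟩
    intro x y hxy
    obtain ⟨_, ⟨c, hc, rfl⟩, h⟩ := h2 x y (by simpa using hxy)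
    exact ⟨c, hc, h⟩

section Order

variable {P : Type u} [PartialOrder P] {Y : Type v} {r : P → Y → Y → Prop} (h : IsRelRep r)
include h

/-- The least element of `P` relating `x` and `y`. -/
noncomputable def theta (x y : Y) : P := (h.principal x y).choose

theorem theta_le {x y : Y} {d : P} : h.theta x y ≤ d ↔ r d x y :=
  ((h.principal x y).choose_spec d).symm

theorem mono {a b : P} (hab : a ≤ b) {x y : Y} (hxy : r a x y) : r b x y :=
  h.theta_le.1 ((h.theta_le.2 hxy).trans hab)

/-- Directed joins are unions, so a pair related by a directed join is already related by one of its
members. -/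
theorem isCompactElement_theta (x y : Y) : IsCompactElement (h.theta x y) := by
  intro s u hs hd hu hle
  obtain ⟨t, ht, h2⟩ := h.directed s hs hd
  obtain ⟨c, hc, hr⟩ := h2 x y (h.mono (hu.2 ht) (h.theta_le.1 hle))
  exact ⟨c, hc, h.theta_le.2 hr⟩

end Order

section Complete

variable {D : Type u} [CompleteLattice D] {Y : Type v} {r : D → Y → Y → Prop} (h : IsRelRep r)
include h

theorem sSup_theta (a : D) : sSup {c | ∃ x y, r a x y ∧ h.theta x y = c} = a := by
  apply le_antisymm
  · apply sSup_le
    rintro _ ⟨x, y, hxy, rfl⟩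
    exact h.theta_le.2 hxy
  · exact h.le _ _ fun x y hxy => h.theta_le.1 (le_sSup ⟨x, y, hxy, rfl⟩)

theorem isCompactlyGenerated : IsCompactlyGenerated D :=
  ⟨fun a => ⟨_, by rintro _ ⟨x, y, -, rfl⟩; exact h.isCompactElement_theta x y, h.sSup_theta a⟩⟩

/-- The least compact element relating `x` and `y`. -/
noncomputable def dist (x y : Y) : CompactElements D := ⟨h.theta x y, h.isCompactElement_theta x y⟩

theorem dist_le {x y : Y} {d : CompactElements D} : h.dist x y ≤ d ↔ r d.1 x y := h.theta_le

/-- Every element is the join of the principal elements below it; compactness leaves finitely many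
of them. -/
theorem exists_eq_sup_dist (s : CompactElements D) :
    ∃ t : Finset (Y × Y), s = t.sup fun p => h.dist p.1 p.2 := by
  classical
  obtain ⟨T, hT, hle⟩ := (CompleteLattice.isCompactElement_iff_exists_le_sSup_of_le_sSup D s.1).1 s.2
    _ (h.sSup_theta s.1).ge
  choose f g hfg using fun c : T => hT c.2
  refine ⟨T.attach.image fun c => (f c, g c), le_antisymm ?_ ?_⟩
  · have key : ∀ d : CompactElements D, (∀ c ∈ T, c ≤ d.1) → s ≤ d := fun d hd =>
      hle.trans (Finset.sup_le hd)
    refine key _ fun c hc => ?_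
    have : h.dist (f ⟨c, hc⟩) (g ⟨c, hc⟩) ≤
        (T.attach.image fun c => (f c, g c)).sup fun p => h.dist p.1 p.2 :=
      Finset.le_sup (f := fun p : Y × Y => h.dist p.1 p.2) (b := (f ⟨c, hc⟩, g ⟨c, hc⟩))
        (Finset.mem_image.2 ⟨⟨c, hc⟩, Finset.mem_attach T _, rfl⟩)
    calc c = h.theta (f ⟨c, hc⟩) (g ⟨c, hc⟩) := (hfg ⟨c, hc⟩).2.symm
      _ ≤ _ := this
  · refine Finset.sup_le fun p hp => ?_
    obtain ⟨c, -, rfl⟩ := Finset.mem_image.1 hp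
    exact h.dist_le.2 (hfg c).1

theorem rangeJoinGenerates_dist : RangeJoinGenerates h.dist := h.exists_eq_sup_dist

theorem isVDistanceThreeHalves_dist (hp : IsAlmostPermutable r) :
    IsVDistanceThreeHalves h.dist where
  self x := le_bot_iff.1 (h.dist_le.2 ((h.equiv _).refl x))
  symm x y := le_antisymm (h.dist_le.2 ((h.equiv _).symm (h.dist_le.1 le_rfl)))
    (h.dist_le.2 ((h.equiv _).symm (h.dist_le.1 le_rfl)))
  triangle x y z := h.dist_le.2
    ((h.equiv _).trans (h.dist_le.1 le_sup_left) (h.dist_le.1 le_sup_right))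
  v_condition x y a b hab := by
    obtain ⟨s, has, hbs, hs⟩ := hp a.1 b.1
    have hle : (a ⊔ b).1 ≤ s := sup_le has hbs
    rcases hs x y (h.mono hle (h.dist_le.1 hab)) with ⟨z, h1, h2⟩ | ⟨z, h1, h2⟩
    · exact ⟨z, Or.inl ⟨h.dist_le.2 h1, h.dist_le.2 h2⟩⟩
    · exact ⟨z, Or.inr ⟨h.dist_le.2 h1, h.dist_le.2 h2⟩⟩

end Complete

end IsRelRep

/-! ### Representations of congruence lattices -/

theorem LatticeCon.isRelRep (α : Type u) [Lattice α] :
    IsRelRep fun (c : LatticeCon α) x y => c.r x y where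
  equiv a := a.iseqv
  le a b hab := hab
  principal x y := ⟨sInf {c | c.r x y}, fun d =>
    ⟨fun hd => sInf_le hd, fun hd => hd (fun c hc => hc : (sInf {c : LatticeCon α | c.r x y}).r x y)⟩⟩
  directed C hC hd := by
    have key : ∀ {w x y z}, (∃ c ∈ C, c.r w x) → (∃ c ∈ C, c.r y z) →
        ∃ c ∈ C, c.r w x ∧ c.r y z := by
      rintro w x y z ⟨c, hc, h1⟩ ⟨d, hd', h2⟩
      obtain ⟨f, hf, hcf, hdf⟩ := hd c hc d hd'
      exact ⟨f, hf, hcf h1, hdf h2⟩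
    refine ⟨{ r := fun x y => ∃ c ∈ C, c.r x y, iseqv := ⟨?_, ?_, ?_⟩, inf := ?_, sup := ?_ },
      fun c hc x y hxy => ⟨c, hc, hxy⟩, fun x y hxy => hxy⟩
    · exact fun x => ⟨_, hC.some_mem, hC.some.iseqv.refl x⟩
    · rintro x y ⟨c, hc, hxy⟩
      exact ⟨c, hc, c.iseqv.symm hxy⟩
    · intro x y z h1 h2
      obtain ⟨c, hc, h1, h2⟩ := key h1 h2
      exact ⟨c, hc, c.iseqv.trans h1 h2⟩
    · intro w x y z h1 h2
      obtain ⟨c, hc, h1, h2⟩ := key h1 h2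
      exact ⟨c, hc, c.inf h1 h2⟩
    · intro w x y z h1 h2
      obtain ⟨c, hc, h1, h2⟩ := key h1 h2
      exact ⟨c, hc, c.sup h1 h2⟩

theorem DirectedOn.exists_forall_fin {P : Type u} [Preorder P] {C : Set P} (hC : C.Nonempty)
    (hd : DirectedOn (· ≤ ·) C) : ∀ {n : ℕ} (c : Fin n → P), (∀ k, c k ∈ C) →
      ∃ d ∈ C, ∀ k, c k ≤ d
  | 0, _, _ => ⟨_, hC.some_mem, fun k => k.elim0⟩
  | n + 1, c, hc => by
    obtain ⟨d, hd', h⟩ := hd.exists_forall_fin hC (fun k : Fin n => c k.succ) fun k => hc _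
    obtain ⟨f, hf, h1, h2⟩ := hd d hd' (c 0) (hc 0)
    exact ⟨f, hf, Fin.cases h2 fun k => (h k).trans h1⟩

theorem AlgebraCon.isRelRep {A : Type u} (𝔸 : AlgebraStructure.{u, v} A) :
    IsRelRep fun (c : AlgebraCon 𝔸) x y => c.r x y where
  equiv a := a.iseqv
  le a b hab := hab
  principal x y := ⟨sInf {c | c.r x y}, fun d =>
    ⟨fun hd => sInf_le hd, fun hd => hd (fun c hc => hc : (sInf {c : AlgebraCon 𝔸 | c.r x y}).r x y)⟩⟩
  directed C hC hd := by
    refine ⟨{ r := fun x y => ∃ c ∈ C, c.r x y, iseqv := ⟨?_, ?_, ?_⟩, compat := ?_ },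
      fun c hc x y hxy => ⟨c, hc, hxy⟩, fun x y hxy => hxy⟩
    · exact fun x => ⟨_, hC.some_mem, hC.some.iseqv.refl x⟩
    · rintro x y ⟨c, hc, hxy⟩
      exact ⟨c, hc, c.iseqv.symm hxy⟩
    · rintro x y z ⟨c, hc, h1⟩ ⟨d, hd', h2⟩
      obtain ⟨f, hf, hcf, hdf⟩ := hd c hc d hd'
      exact ⟨f, hf, f.iseqv.trans (hcf h1) (hdf h2)⟩
    · intro i x y h
      choose c hc hr using h
      obtain ⟨d, hd', hle⟩ := hd.exists_forall_fin hC c hc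
      exact ⟨d, hd', d.compat i x y fun k => hle k (hr k)⟩

theorem AlgebraStructure.HasAlmostPermutableCongruences.isAlmostPermutable {A : Type u}
    {𝔸 : AlgebraStructure.{u, v} A} (h : 𝔸.HasAlmostPermutableCongruences) :
    IsAlmostPermutable fun (c : AlgebraCon 𝔸) x y => c.r x y :=
  fun a b => ⟨a ⊔ b, le_sup_left, le_sup_right, fun x y => (h a b x y).1⟩

theorem Submodule.isRelRep (R : Type u) (M : Type v) [Ring R] [AddCommGroup M] [Module R M] :
    IsRelRep fun (N : Submodule R M) x y => x - y ∈ N where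
  equiv N := ⟨fun x => by simp, fun {x y} h => by simpa using N.neg_mem h,
    fun {x y z} h1 h2 => by simpa using N.add_mem h1 h2⟩
  le N K h x hx := by simpa using h x 0 (by simpa using hx)
  principal x y := ⟨Submodule.span R {x - y}, fun d => by simp [Submodule.span_le]⟩
  directed C hC hd := ⟨sSup C, fun c hc => le_sSup hc, fun x y hxy =>
    (Submodule.mem_sSup_of_directed hC hd).1 hxy⟩

theorem Submodule.isAlmostPermutable (R : Type u) (M : Type v) [Ring R] [AddCommGroup M]
    [Module R M] : IsAlmostPermutable fun (N : Submodule R M) x y => x - y ∈ N := by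
  refine fun a b => ⟨a ⊔ b, le_sup_left, le_sup_right, fun x y h => Or.inl ?_⟩
  obtain ⟨n, hn, k, hk, hnk⟩ := Submodule.mem_sup.1 h
  exact ⟨x - n, by simpa using hn, by
    have : x - n - y = k := by rw [sub_right_comm, ← hnk]; abel
    simpa [this] using hk⟩

/-! ### Representations by subgroups -/

/-- Subgroups act by their left cosets. The predicate `p` lets normal subgroups and `ℓ`-ideals be
treated together. -/
theorem isRelRep_subgroups {G : Type u} [Group G] {p : Subgroup G → Prop}
    (hinf : ∀ C : Set (Subgroup G), (∀ N ∈ C, p N) → p (sInf C))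
    (hdir : ∀ C : Set (Subgroup G), C.Nonempty → DirectedOn (· ≤ ·) C → (∀ N ∈ C, p N) →
      p (sSup C)) :
    IsRelRep fun (N : {N : Subgroup G // p N}) x y => x⁻¹ * y ∈ N.1 where
  equiv N := ⟨fun x => by simp, fun {x y} h => by simpa using N.1.inv_mem h,
    fun {x y z} h1 h2 => by simpa [mul_assoc] using N.1.mul_mem h1 h2⟩
  le N K h x hx := by simpa using h 1 x (by simpa using hx)
  principal x y := by
    refine ⟨⟨sInf {N | p N ∧ x⁻¹ * y ∈ N}, hinf _ fun N hN => hN.1⟩, fun d => ⟨fun h => ?_, fun h => ?_⟩⟩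
    · exact sInf_le (show d.1 ∈ {N | p N ∧ x⁻¹ * y ∈ N} from ⟨d.2, h⟩)
    · exact h (Subgroup.mem_sInf.2 fun N hN => hN.2)
  directed C hC hd := by
    have hd' : DirectedOn (· ≤ ·) (Subtype.val '' C) := by
      rintro _ ⟨a, ha, rfl⟩ _ ⟨b, hb, rfl⟩
      obtain ⟨c, hc, h1, h2⟩ := hd a ha b hb
      exact ⟨_, ⟨c, hc, rfl⟩, h1, h2⟩
    refine ⟨⟨sSup (Subtype.val '' C), hdir _ (hC.image _) hd' ?_⟩, fun c hc => ?_, fun x y h => ?_⟩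
    · rintro _ ⟨a, -, rfl⟩
      exact a.2
    · exact le_sSup (Set.mem_image_of_mem Subtype.val hc)
    · obtain ⟨_, ⟨c, hc, rfl⟩, h⟩ := (Subgroup.mem_sSup_of_directedOn (hC.image _) hd').1 h
      exact ⟨c, hc, h⟩

theorem isAlmostPermutable_subgroups {G : Type u} [Group G] {p : Subgroup G → Prop}
    (hnormal : ∀ N, p N → N.Normal) (hsup : ∀ N K, p N → p K → p (N ⊔ K)) :
    IsAlmostPermutable fun (N : {N : Subgroup G // p N}) x y => x⁻¹ * y ∈ N.1 := by
  rintro ⟨N, hN⟩ ⟨K, hK⟩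
  refine ⟨⟨N ⊔ K, hsup N K hN hK⟩, (le_sup_left : N ≤ N ⊔ K), (le_sup_right : K ≤ N ⊔ K),
    fun x y h => Or.inl ?_⟩
  have := hnormal N hN
  obtain ⟨n, hn, k, hk, hnk⟩ := Subgroup.mem_sup_of_normal_left.1 h
  exact ⟨x * n, by simpa using hn, by simpa [mul_assoc, ← hnk] using hk⟩

theorem Subgroup.normal_sInf {G : Type u} [Group G] {C : Set (Subgroup G)}
    (hC : ∀ N ∈ C, N.Normal) : (sInf C).Normal :=
  ⟨fun n hn g => Subgroup.mem_sInf.2 fun N hN => (hC N hN).conj_mem n (Subgroup.mem_sInf.1 hn N hN) g⟩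

theorem Subgroup.normal_sSup_of_directedOn {G : Type u} [Group G] {C : Set (Subgroup G)}
    (hne : C.Nonempty) (hd : DirectedOn (· ≤ ·) C) (hC : ∀ N ∈ C, N.Normal) : (sSup C).Normal := by
  refine ⟨fun n hn g => ?_⟩
  rw [Subgroup.mem_sSup_of_directedOn hne hd] at hn ⊢
  obtain ⟨N, hN, h⟩ := hn
  exact ⟨N, hN, (hC N hN).conj_mem n h g⟩

theorem normalSubgroup_isRelRep (G : Type u) [Group G] :
    IsRelRep fun (N : {N : Subgroup G // N.Normal}) x y => x⁻¹ * y ∈ N.1 :=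
  isRelRep_subgroups (fun _ => Subgroup.normal_sInf) fun _ => Subgroup.normal_sSup_of_directedOn

theorem normalSubgroup_isAlmostPermutable (G : Type u) [Group G] :
    IsAlmostPermutable fun (N : {N : Subgroup G // N.Normal}) x y => x⁻¹ * y ∈ N.1 :=
  isAlmostPermutable_subgroups (fun _ h => h) fun N K _ _ => Subgroup.sup_normal N K

/-! ### Intersections, directed unions and joins of `ℓ`-ideals -/

section LIdeal

variable {G : Type u} [Group G] [Lattice G]

theorem IsLIdeal.sInf {C : Set (Subgroup G)} (hC : ∀ N ∈ C, IsLIdeal N) : IsLIdeal (sInf C) where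
  normal := Subgroup.normal_sInf fun N hN => (hC N hN).normal
  convex := ⟨fun _ ha _ hb _ hx => Subgroup.mem_sInf.2 fun N hN =>
    (hC N hN).convex.out (Subgroup.mem_sInf.1 ha N hN) (Subgroup.mem_sInf.1 hb N hN) hx⟩
  sup_mem _ _ ha hb := Subgroup.mem_sInf.2 fun N hN =>
    (hC N hN).sup_mem (Subgroup.mem_sInf.1 ha N hN) (Subgroup.mem_sInf.1 hb N hN)
  inf_mem _ _ ha hb := Subgroup.mem_sInf.2 fun N hN =>
    (hC N hN).inf_mem (Subgroup.mem_sInf.1 ha N hN) (Subgroup.mem_sInf.1 hb N hN)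

theorem IsLIdeal.sSup_of_directedOn {C : Set (Subgroup G)} (hne : C.Nonempty)
    (hd : DirectedOn (· ≤ ·) C) (hC : ∀ N ∈ C, IsLIdeal N) : IsLIdeal (sSup C) := by
  have key : ∀ a ∈ sSup C, ∀ b ∈ sSup C, ∃ N ∈ C, a ∈ N ∧ b ∈ N := by
    intro a ha b hb
    obtain ⟨N, hN, ha⟩ := (Subgroup.mem_sSup_of_directedOn hne hd).1 ha
    obtain ⟨K, hK, hb⟩ := (Subgroup.mem_sSup_of_directedOn hne hd).1 hb
    obtain ⟨M, hM, h1, h2⟩ := hd N hN K hK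
    exact ⟨M, hM, h1 ha, h2 hb⟩
  refine ⟨Subgroup.normal_sSup_of_directedOn hne hd fun N hN => (hC N hN).normal,
    ⟨fun a ha b hb x hx => ?_⟩, fun a b ha hb => ?_, fun a b ha hb => ?_⟩
  all_goals obtain ⟨N, hN, ha, hb⟩ := key a ha b hb
  · exact (le_sSup hN : N ≤ _) ((hC N hN).convex.out ha hb hx)
  · exact (le_sSup hN : N ≤ _) ((hC N hN).sup_mem ha hb)
  · exact (le_sSup hN : N ≤ _) ((hC N hN).inf_mem ha hb)

variable [MulLeftMono G] [MulRightMono G]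

/-- Riesz decomposition: if `h = n * k`, then `g ≤ |n| * |k|`, and `g` is the product of `g ⊓ |n|`,
which lies in `N`, and `1 ⊔ |n|⁻¹ * g ≤ |k|`, which lies in `K`. -/
theorem IsLIdeal.mem_sup_of_le {N K : Subgroup G} (hN : IsLIdeal N) (hK : IsLIdeal K) {g h : G}
    (hg : 1 ≤ g) (hgh : g ≤ h) (hh : h ∈ N ⊔ K) : g ∈ N ⊔ K := by
  have := hN.normal
  obtain ⟨n, hn, k, hk, rfl⟩ := Subgroup.mem_sup_of_normal_left.1 hh
  have hn' : mabs n ∈ N := hN.sup_mem hn (N.inv_mem hn)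
  have hk' : mabs k ∈ K := hK.sup_mem hk (K.inv_mem hk)
  have h1 : g ⊓ mabs n ∈ N :=
    hN.convex.out N.one_mem hn' ⟨le_inf hg (one_le_mabs n), inf_le_right⟩
  have h2 : (g ⊓ mabs n)⁻¹ * g = 1 ⊔ (mabs n)⁻¹ * g := by
    rw [inv_inf, sup_mul, inv_mul_cancel]
  have h3 : (mabs n)⁻¹ * g ≤ mabs k := by
    rw [inv_mul_le_iff_le_mul]
    exact hgh.trans (mul_le_mul' (le_mabs_self n) (le_mabs_self k))
  have h4 : (g ⊓ mabs n)⁻¹ * g ∈ K := by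
    rw [h2]
    exact hK.convex.out K.one_mem hk' ⟨le_sup_left, sup_le (one_le_mabs k) h3⟩
  simpa using (N ⊔ K).mul_mem (Subgroup.mem_sup_left (T := K) h1) (Subgroup.mem_sup_right (S := N) h4)

theorem IsLIdeal.sup {N K : Subgroup G} (hN : IsLIdeal N) (hK : IsLIdeal K) :
    IsLIdeal (N ⊔ K) := by
  have hnN := hN.normal
  have hnK := hK.normal
  have h1 : ∀ a ∈ N ⊔ K, a ⊔ 1 ∈ N ⊔ K := by
    intro a ha
    obtain ⟨n, hn, k, hk, rfl⟩ := Subgroup.mem_sup_of_normal_left.1 ha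
    refine hN.mem_sup_of_le hK le_sup_right (h := mabs n * mabs k)
      (sup_le (mul_le_mul' (le_mabs_self n) (le_mabs_self k))
        (one_le_mul (one_le_mabs n) (one_le_mabs k))) ?_
    exact (N ⊔ K).mul_mem (Subgroup.mem_sup_left (hN.sup_mem hn (N.inv_mem hn)))
      (Subgroup.mem_sup_right (hK.sup_mem hk (K.inv_mem hk)))
  -- Translation reduces to a join with `1`: `a ⊔ b = (a * b⁻¹ ⊔ 1) * b`.
  have h2 : ∀ a ∈ N ⊔ K, ∀ b ∈ N ⊔ K, a ⊔ b ∈ N ⊔ K := by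
    intro a ha b hb
    have := (N ⊔ K).mul_mem (h1 _ ((N ⊔ K).mul_mem ha ((N ⊔ K).inv_mem hb))) hb
    simpa [sup_mul] using this
  refine ⟨Subgroup.sup_normal N K, ⟨fun a ha b hb x hx => ?_⟩, fun a b ha hb => h2 a ha b hb,
    fun a b ha hb => ?_⟩
  · have := hN.mem_sup_of_le hK (g := a⁻¹ * x) (h := a⁻¹ * b) (by simpa using hx.1)
      (mul_le_mul_right hx.2 _) ((N ⊔ K).mul_mem ((N ⊔ K).inv_mem ha) hb)
    simpa using (N ⊔ K).mul_mem ha this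
  · have := (N ⊔ K).inv_mem (h2 _ ((N ⊔ K).inv_mem ha) _ ((N ⊔ K).inv_mem hb))
    simpa [inv_sup] using this

end LIdeal

theorem lIdeal_isRelRep (G : Type u) [Group G] [Lattice G] :
    IsRelRep fun (N : {N : Subgroup G // IsLIdeal N}) x y => x⁻¹ * y ∈ N.1 :=
  isRelRep_subgroups (fun _ => IsLIdeal.sInf) fun _ => IsLIdeal.sSup_of_directedOn

theorem lIdeal_isAlmostPermutable (G : Type u) [Group G] [Lattice G] [MulLeftMono G]
    [MulRightMono G] :
    IsAlmostPermutable fun (N : {N : Subgroup G // IsLIdeal N}) x y => x⁻¹ * y ∈ N.1 :=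
  isAlmostPermutable_subgroups (fun _ h => h.normal) fun _ _ => IsLIdeal.sup

/-! ### Distributivity of congruence lattices of lattices -/

namespace LatticeCon

variable {α : Type u} [Lattice α]

open Relation

/-- The transitive closure of the union is preserved by each one-variable translation, hence is
itself a congruence above both. -/
theorem reflTransGen_of_sup {b c : LatticeCon α} {x y : α} (h : (b ⊔ c).r x y) :
    ReflTransGen (fun x y => b.r x y ∨ c.r x y) x y := by
  have key : ∀ f : α → α, (∀ d : LatticeCon α, ∀ x y, d.r x y → d.r (f x) (f y)) → ∀ {x y},
      ReflTransGen (fun x y => b.r x y ∨ c.r x y) x y →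
      ReflTransGen (fun x y => b.r x y ∨ c.r x y) (f x) (f y) := fun f hf x y h =>
    h.lift f fun u v h => h.imp (hf b u v) (hf c u v)
  let d : LatticeCon α :=
    { r := ReflTransGen fun x y => b.r x y ∨ c.r x y
      iseqv := ⟨fun _ => .refl, fun h => (@ReflTransGen.stdSymm _ _
        ⟨fun _ _ h => h.imp b.iseqv.symm c.iseqv.symm⟩).symm _ _ h, fun h1 h2 => h1.trans h2⟩
      inf := fun {w x y z} h1 h2 =>
        (key (· ⊓ y) (fun d _ _ h => d.inf h (d.iseqv.refl _)) h1).trans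
          (key (x ⊓ ·) (fun d _ _ h => d.inf (d.iseqv.refl _) h) h2)
      sup := fun {w x y z} h1 h2 =>
        (key (· ⊔ y) (fun d _ _ h => d.sup h (d.iseqv.refl _)) h1).trans
          (key (x ⊔ ·) (fun d _ _ h => d.sup (d.iseqv.refl _) h) h2) }
  have hb : b ≤ d := fun x y h => ReflTransGen.single (Or.inl h)
  have hc : c ≤ d := fun x y h => ReflTransGen.single (Or.inr h)
  exact sup_le hb hc h

theorem inf_r {a b : LatticeCon α} {x y : α} : (a ⊓ b).r x y ↔ a.r x y ∧ b.r x y := by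
  constructor
  · exact fun h => ⟨(inf_le_left : a ⊓ b ≤ a) h, (inf_le_right : a ⊓ b ≤ b) h⟩
  · rintro ⟨h1, h2⟩
    exact (LatticeCon.isRelRep α).theta_le.1
      (le_inf ((LatticeCon.isRelRep α).theta_le.2 h1) ((LatticeCon.isRelRep α).theta_le.2 h2))

/-- Apply the majority term `m = m(x, y, ·)` to a chain of `b`- and `c`-steps from `x` to `y`. The
ends stay fixed, and since `a` relates `x` to `y`, the whole image lies in one class of `a`; so its
steps belong to `a ⊓ b` or `a ⊓ c`. -/
theorem isDistribLattice : IsDistribLattice (LatticeCon α) := by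
  intro a b c
  refine le_antisymm (fun x y hxy => ?_) le_inf_sup
  obtain ⟨ha, h⟩ := inf_r.1 hxy
  let m : α → α := fun z => (x ⊓ y ⊔ x ⊓ z) ⊔ y ⊓ z
  have hm : ∀ d : LatticeCon α, ∀ u v, d.r u v → d.r (m u) (m v) := fun d u v h =>
    d.sup (d.sup (d.iseqv.refl _) (d.inf (d.iseqv.refl _) h)) (d.inf (d.iseqv.refl _) h)
  have hxm : ∀ u, a.r x (m u) := by
    intro u
    have : a.r ((x ⊓ x ⊔ x ⊓ u) ⊔ x ⊓ u) (m u) :=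
      a.sup (a.sup (a.inf (a.iseqv.refl _) ha) (a.iseqv.refl _)) (a.inf ha (a.iseqv.refl _))
    simpa using this
  have hmx : m x = x := by simp [m, inf_comm y x]
  have hmy : m y = y := by simp [m]
  have key : ∀ z, ReflTransGen (fun x y => b.r x y ∨ c.r x y) x z →
      ((a ⊓ b) ⊔ (a ⊓ c)).r (m x) (m z) := by
    intro z hz
    induction hz with
    | refl => exact Setoid.refl' _ _
    | @tail u v _ h ih =>
      refine Setoid.trans' _ ih ?_
      have hax := a.iseqv.trans (a.iseqv.symm (hxm u)) (hxm v)
      rcases h with h | h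
      · exact (le_sup_left : a ⊓ b ≤ _) (inf_r.2 ⟨hax, hm b _ _ h⟩)
      · exact (le_sup_right : a ⊓ c ≤ _) (inf_r.2 ⟨hax, hm c _ _ h⟩)
  have := key y (reflTransGen_of_sup h)
  rwa [hmx, hmy] at this

end LatticeCon

/-! ### Lattices generated by families of elements -/

/-- Lattice terms with variables in `X`. -/
inductive LatticeTermOver (X : Type u) : Type u where
  | var : X → LatticeTermOver X
  | sup : LatticeTermOver X → LatticeTermOver X → LatticeTermOver X
  | inf : LatticeTermOver X → LatticeTermOver X → LatticeTermOver X

/-- The value of a term. -/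
def LatticeTermOver.eval {X : Type u} {P : Type v} [Lattice P] (f : X → P) : LatticeTermOver X → P
  | .var x => f x
  | .sup s t => s.eval f ⊔ t.eval f
  | .inf s t => s.eval f ⊓ t.eval f

theorem LatticeTerm.map_eval {L : Type u} {M : Type v} [Lattice L] [Lattice M] (g : L → M)
    (hsup : ∀ a b, g (a ⊔ b) = g a ⊔ g b) (hinf : ∀ a b, g (a ⊓ b) = g a ⊓ g b) (f : ℕ → L) :
    ∀ t : LatticeTerm, g (t.eval f) = t.eval (g ∘ f)
  | .var n => rfl
  | .sup s t => by
    simp only [LatticeTerm.eval, hsup, map_eval g hsup hinf f s, map_eval g hsup hinf f t]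
  | .inf s t => by
    simp only [LatticeTerm.eval, hinf, map_eval g hsup hinf f s, map_eval g hsup hinf f t]

theorem LatticeVariety.Mem.of_injective {V : LatticeVariety} {L : Type u} {M : Type v} [Lattice L]
    [Lattice M] (hM : V.Mem M) (g : L → M) (hg : Function.Injective g)
    (hsup : ∀ a b, g (a ⊔ b) = g a ⊔ g b) (hinf : ∀ a b, g (a ⊓ b) = g a ⊓ g b) : V.Mem L :=
  fun p hp f => hg <| by
    rw [LatticeTerm.map_eval g hsup hinf, LatticeTerm.map_eval g hsup hinf, hM p hp]

theorem LatticeVariety.Mem.pi {V : LatticeVariety} {ι : Type u} {L : ι → Type v}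
    [∀ i, Lattice (L i)] (h : ∀ i, V.Mem (L i)) : V.Mem (∀ i, L i) := by
  intro p hp f
  funext i
  have := LatticeTerm.map_eval (fun a : ∀ i, L i => a i) (fun _ _ => rfl) (fun _ _ => rfl) f
  rw [this, this, h i p hp]

/-- The lattice generated by a family `f` of elements of `P`, as a quotient of a term algebra. -/
def GeneratedLattice {X : Type u} {P : Type v} [Lattice P] (f : X → P) : Type u :=
  Quotient (Setoid.ker (LatticeTermOver.eval f))

namespace GeneratedLattice

variable {X : Type u} {P : Type v} [Lattice P] (f : X → P)

/-- The inclusion of the generated lattice. -/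
def val : GeneratedLattice f → P := Quotient.lift (LatticeTermOver.eval f) fun _ _ h => h

theorem val_injective : Function.Injective (val f) := by
  rintro ⟨a⟩ ⟨b⟩ h
  exact Quotient.sound h

instance : Max (GeneratedLattice f) :=
  ⟨Quotient.map₂ .sup fun _ _ h1 _ _ h2 => congrArg₂ (· ⊔ ·) h1 h2⟩

instance : Min (GeneratedLattice f) :=
  ⟨Quotient.map₂ .inf fun _ _ h1 _ _ h2 => congrArg₂ (· ⊓ ·) h1 h2⟩

instance : LE (GeneratedLattice f) := ⟨fun a b => val f a ≤ val f b⟩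

instance : LT (GeneratedLattice f) := ⟨fun a b => val f a < val f b⟩

theorem val_sup (a b : GeneratedLattice f) : val f (a ⊔ b) = val f a ⊔ val f b := by
  rcases a with ⟨a⟩; rcases b with ⟨b⟩; rfl

theorem val_inf (a b : GeneratedLattice f) : val f (a ⊓ b) = val f a ⊓ val f b := by
  rcases a with ⟨a⟩; rcases b with ⟨b⟩; rfl

instance : Lattice (GeneratedLattice f) :=
  (val_injective f).lattice _ Iff.rfl Iff.rfl (val_sup f) (val_inf f)

/-- The generators. -/
def of (x : X) : GeneratedLattice f := Quotient.mk _ (.var x)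

theorem mem {V : LatticeVariety} (h : V.Mem P) : V.Mem (GeneratedLattice f) :=
  h.of_injective (val f) (val_injective f) (val_sup f) (val_inf f)

variable {f}

theorem induction {p : GeneratedLattice f → Prop} (hof : ∀ x, p (of f x))
    (hsup : ∀ a b, p a → p b → p (a ⊔ b)) (hinf : ∀ a b, p a → p b → p (a ⊓ b)) (a) : p a := by
  rcases a with ⟨t⟩
  induction t with
  | var x => exact hof x
  | sup s t hs ht => exact hsup _ _ hs ht
  | inf s t hs ht => exact hinf _ _ hs ht

end GeneratedLattice

/-! ### Free lattices -/

namespace LatticeVariety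

variable (V : LatticeVariety)

/-- The assignments of the generators `X` in the members of `V`. -/
structure Assignment (X : Type u) : Type (u + 1) where
  carrier : Type u
  lattice : Lattice carrier
  mem : V.Mem carrier
  toFun : X → carrier

instance (X : Type u) (i : V.Assignment X) : Lattice i.carrier := i.lattice

/-- The free lattice on `X` in the variety `V`. -/
abbrev Free (X : Type u) : Type u :=
  GeneratedLattice fun (x : X) (i : V.Assignment X) => i.toFun x

/-- The tautological generators in the product of all assignments generate a free lattice: extending
an assignment is projecting to its coordinate. The product lives one universe too high, but the
quotient of terms stays in that of `X`. -/
theorem exists_isFree (X : Type u) :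
    ∃ (F : Type u) (_ : Lattice F) (ι : X → F), V.IsFree ι := by
  refine ⟨V.Free X, inferInstance, GeneratedLattice.of _,
    GeneratedLattice.mem _ (Mem.pi fun i => i.mem), fun L _ hL f => ?_⟩
  let i : V.Assignment X := ⟨L, inferInstance, hL, f⟩
  refine ⟨⟨⟨fun a => GeneratedLattice.val _ a i, fun a b => ?_⟩, fun a b => ?_⟩, fun x => rfl,
    fun g hg => ?_⟩
  · exact congrFun (GeneratedLattice.val_sup _ a b) i
  · exact congrFun (GeneratedLattice.val_inf _ a b) i
  · ext a
    induction a using GeneratedLattice.induction with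
    | hof x => exact hg x
    | hsup a b ha hb => exact (g.map_sup' a b).trans ((congrArg₂ (· ⊔ ·) ha hb).trans
        (congrFun (GeneratedLattice.val_sup _ a b) i).symm)
    | hinf a b ha hb => exact (g.map_inf' a b).trans ((congrArg₂ (· ⊓ ·) ha hb).trans
        (congrFun (GeneratedLattice.val_inf _ a b) i).symm)

/-- The common features of free and free bounded lattices: `F` is generated by the range of `ι` and
two sets of constants, and homomorphisms to bounded lattices in `V` can be prescribed on `X`,
mapping the constants to the bounds. -/
structure IsFreeOver {X F : Type u} [Lattice F] (ι : X → F) (C₀ C₁ : Set F) : Prop where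
  induction : ∀ p : F → Prop, (∀ x, p (ι x)) → (∀ c ∈ C₀, p c) → (∀ c ∈ C₁, p c) →
    (∀ a b, p a → p b → p (a ⊔ b)) → (∀ a b, p a → p b → p (a ⊓ b)) → ∀ a, p a
  lift : ∀ (L : Type u) [Lattice L] [BoundedOrder L], V.Mem L → ∀ f : X → L,
    ∃ g : LatticeHom F L, (∀ x, g (ι x) = f x) ∧ (∀ c ∈ C₀, g c = ⊥) ∧ ∀ c ∈ C₁, g c = ⊤

variable {V}

/-- The sublattice given by a predicate closed under the operations. -/
def sublatticeOf {F : Type u} [Lattice F] (p : F → Prop) (hsup : ∀ a b, p a → p b → p (a ⊔ b))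
    (hinf : ∀ a b, p a → p b → p (a ⊓ b)) : Sublattice F :=
  ⟨{a | p a}, fun a ha b hb => hsup a b ha hb, fun a ha b hb => hinf a b ha hb⟩

/-- For induction, lift the generators into the sublattice cut out by `p`; by uniqueness, following
the lift by the inclusion is the identity. -/
theorem IsFree.isFreeOver {X F : Type u} [Lattice F] {ι : X → F} (h : V.IsFree ι) :
    V.IsFreeOver ι ∅ ∅ where
  induction p hp _ _ hsup hinf a := by
    let S := sublatticeOf p hsup hinf
    have hS : V.Mem S := h.1.of_injective _ S.subtype_injective (fun _ _ => rfl) fun _ _ => rfl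
    obtain ⟨g, hg, -⟩ := h.2 S hS fun x => ⟨ι x, hp x⟩
    have : S.subtype.comp g = LatticeHom.id F :=
      (h.2 F h.1 ι).unique (fun x => by simp [hg]) fun x => rfl
    have h2 : ((g a : S) : F) = a := congrArg (fun k : LatticeHom F F => k a) this
    exact h2 ▸ (g a).2
  lift L _ _ hL f := by
    obtain ⟨g, hg, -⟩ := h.2 L hL f
    exact ⟨g, hg, by simp, by simp⟩

theorem IsFreeBounded.exists_isFreeOver {X F : Type u} [Lattice F] {ι : X → F}
    (h : V.IsFreeBounded ι) : ∃ a b : F, V.IsFreeOver ι {a} {b} := by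
  obtain ⟨_, hF, h⟩ := h
  refine ⟨⊥, ⊤, ⟨fun p hp h0 h1 hsup hinf a => ?_, fun L _ _ hL f => ?_⟩⟩
  · let S := sublatticeOf p hsup hinf
    have hS : V.Mem S := hF.of_injective _ S.subtype_injective (fun _ _ => rfl) fun _ _ => rfl
    let _ : BoundedOrder S :=
      { top := ⟨⊤, h1 _ rfl⟩
        bot := ⟨⊥, h0 _ rfl⟩
        le_top := fun a => (le_top : (a : F) ≤ ⊤)
        bot_le := fun a => (bot_le : ⊥ ≤ (a : F)) }
    obtain ⟨g, hg, -⟩ := h S hS fun x => ⟨ι x, hp x⟩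
    let k : BoundedLatticeHom F F :=
      { S.subtype.comp g.toLatticeHom with
        map_top' := congrArg Subtype.val (map_top g)
        map_bot' := congrArg Subtype.val (map_bot g) }
    have : k = BoundedLatticeHom.id F :=
      (h F hF ι).unique (fun x => congrArg Subtype.val (hg x)) fun x => rfl
    have h2 : ((g a : S) : F) = a := congrArg (fun k : BoundedLatticeHom F F => k a) this
    exact h2 ▸ (g a).2
  · obtain ⟨g, hg, -⟩ := h L hL f
    exact ⟨g.toLatticeHom, hg, by rintro _ rfl; exact map_bot g, by rintro _ rfl; exact map_top g⟩

end LatticeVariety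

/-! ### Complements in non-distributive lattices -/

/-- A lattice in which distinct elements have no common relative complement is distributive. -/
theorem isDistribLattice_of_cancel {M : Type u} [Lattice M]
    (h : ∀ x y z : M, x ⊓ y = z ⊓ y → x ⊔ y = z ⊔ y → x = z) : IsDistribLattice M := by
  -- No pentagon: the two sides of the modular law have the same meet and the same join with `b`.
  have hmod : ∀ a b c : M, a ≤ c → (a ⊔ b) ⊓ c = a ⊔ b ⊓ c := by
    intro a b c hac
    have hle : a ⊔ b ⊓ c ≤ (a ⊔ b) ⊓ c :=
      sup_le (le_inf le_sup_left hac) (inf_le_inf_right c le_sup_right)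
    refine h _ b _ (le_antisymm ?_ (inf_le_inf_right b hle))
      (le_antisymm ?_ (sup_le_sup_right hle b))
    · exact le_inf (le_sup_of_le_right (le_inf inf_le_right (inf_le_left.trans inf_le_right)))
        inf_le_right
    · exact sup_le (inf_le_left.trans (sup_le (le_sup_of_le_left le_sup_left) le_sup_right))
        le_sup_right
  -- the three elements of the median diamond
  have hinf : ∀ a b c : M, (a ⊔ b ⊓ c) ⊓ (b ⊔ c) ⊓ ((b ⊔ c ⊓ a) ⊓ (c ⊔ a)) =
      a ⊓ b ⊔ b ⊓ c ⊔ c ⊓ a := by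
    intro a b c
    have h1 : (a ⊔ b ⊓ c) ⊓ (b ⊔ c) ⊓ ((b ⊔ c ⊓ a) ⊓ (c ⊔ a)) = (a ⊔ b ⊓ c) ⊓ (b ⊔ c ⊓ a) := by
      apply le_antisymm
      · exact le_inf (inf_le_left.trans inf_le_left) (inf_le_right.trans inf_le_left)
      · exact le_inf (le_inf inf_le_left (inf_le_right.trans (sup_le_sup_left inf_le_left b)))
          (le_inf inf_le_right (inf_le_left.trans
            (sup_le le_sup_right (inf_le_right.trans le_sup_left))))
    have h2 := hmod (c ⊓ a) b (a ⊔ b ⊓ c) (inf_le_right.trans le_sup_left)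
    have h3 := hmod (b ⊓ c) a b inf_le_left
    rw [h1, inf_comm, sup_comm b, h2, inf_comm b, sup_comm a, h3]
    ac_rfl
  have hsup : ∀ a b c : M, (a ⊔ b ⊓ c) ⊓ (b ⊔ c) ⊔ (b ⊔ c ⊓ a) ⊓ (c ⊔ a) =
      (a ⊔ b) ⊓ (b ⊔ c) ⊓ (c ⊔ a) := by
    intro a b c
    have e1 : (a ⊔ b ⊓ c) ⊓ (b ⊔ c) = b ⊓ c ⊔ a ⊓ (b ⊔ c) := by
      rw [sup_comm a, hmod _ _ _ (inf_le_left.trans le_sup_left)]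
    have e2 : (b ⊔ c ⊓ a) ⊓ (c ⊔ a) = c ⊓ a ⊔ b ⊓ (c ⊔ a) := by
      rw [sup_comm b, hmod _ _ _ (inf_le_left.trans le_sup_left)]
    have h1 : b ⊓ c ⊔ a ⊓ (b ⊔ c) ⊔ (c ⊓ a ⊔ b ⊓ (c ⊔ a)) = a ⊓ (b ⊔ c) ⊔ b ⊓ (c ⊔ a) := by
      apply le_antisymm
      · exact sup_le (sup_le (le_sup_of_le_right (inf_le_inf_left b le_sup_left)) le_sup_left)
          (sup_le (le_sup_of_le_left (le_inf inf_le_right (inf_le_left.trans le_sup_right)))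
            le_sup_right)
      · exact sup_le_sup le_sup_right le_sup_right
    have h2 := hmod (a ⊓ (b ⊔ c)) b (c ⊔ a) (inf_le_left.trans le_sup_right)
    have h3 := hmod b a (b ⊔ c) le_sup_left
    rw [e1, e2, h1, ← h2, sup_comm (a ⊓ (b ⊔ c)), ← h3, sup_comm b a]
  -- No diamond: the three elements have the lower median as pairwise meet and the upper median as
  -- pairwise join. Cancellation identifies two of them, so the medians agree; meeting both with `a`
  -- then gives distributivity.
  have key : ∀ a b c : M, a ⊓ b ⊔ b ⊓ c ⊔ c ⊓ a = (a ⊔ b) ⊓ (b ⊔ c) ⊓ (c ⊔ a) := by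
    intro a b c
    have h1 := hinf a b c
    have h2 := hinf b c a
    have h3 := hsup a b c
    have h4 := hsup b c a
    have h5 := hinf c a b
    have h6 := hsup c a b
    have : (a ⊔ b ⊓ c) ⊓ (b ⊔ c) = (b ⊔ c ⊓ a) ⊓ (c ⊔ a) := by
      refine h _ ((c ⊔ a ⊓ b) ⊓ (a ⊔ b)) _ ?_ ?_
      · rw [inf_comm, h5, h2]; ac_rfl
      · rw [sup_comm, h6, h4]; ac_rfl
    rw [← h1, ← h3, this, inf_idem, sup_idem]
  intro a b c
  have h1 : a ⊓ ((a ⊔ b) ⊓ (b ⊔ c) ⊓ (c ⊔ a)) = a ⊓ (b ⊔ c) := by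
    apply le_antisymm
    · exact inf_le_inf_left a (inf_le_left.trans inf_le_right)
    · exact le_inf inf_le_left (le_inf (le_inf (inf_le_left.trans le_sup_left) inf_le_right)
        (inf_le_left.trans le_sup_right))
  have h2 := hmod (a ⊓ b ⊔ c ⊓ a) (b ⊓ c) a (sup_le inf_le_left inf_le_right)
  rw [← h1, ← key, inf_comm, sup_right_comm, h2, sup_eq_left.2, inf_comm c a]
  exact le_sup_of_le_left (le_inf inf_le_right (inf_le_left.trans inf_le_left))

/-- A non-distributive variety has a bounded member with two distinct complements of an element. -/
theorem LatticeVariety.IsNonDistributive.exists_complements {V : LatticeVariety}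
    (hV : LatticeVariety.IsNonDistributive.{w} V) :
    ∃ (L : Type u) (_ : Lattice L) (_ : BoundedOrder L), V.Mem L ∧
      ∃ x y z : L, IsCompl x y ∧ IsCompl z y ∧ ¬ x ≤ z := by
  obtain ⟨M, _, hM, hd⟩ := hV
  obtain ⟨x, y, z, hinf, hsup, hxz⟩ :
      ∃ x y z : M, x ⊓ y = z ⊓ y ∧ x ⊔ y = z ⊔ y ∧ ¬ x ≤ z := by
    by_contra! h
    exact hd (isDistribLattice_of_cancel fun x y z h1 h2 =>
      le_antisymm (h x y z h1 h2) (h z y x h1.symm h2.symm))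
  -- The sublattice generated by `x, y, z` has the bounds `x ⊓ y` and `x ⊔ y`; building it from
  -- lifted indices also moves it to the required universe.
  let f : ULift.{u} (Fin 3) → M := fun i => ![x, y, z] i.down
  let o : Fin 3 → GeneratedLattice f := fun i => .of f ⟨i⟩
  have hbot : ∀ a, GeneratedLattice.val f (o 0 ⊓ o 1) ≤ GeneratedLattice.val f a := by
    intro a
    induction a using GeneratedLattice.induction with
    | hof i =>
      obtain ⟨i⟩ := i
      rw [GeneratedLattice.val_inf]
      fin_cases i
      · exact inf_le_left
      · exact inf_le_right
      · exact (hinf.le.trans inf_le_left : x ⊓ y ≤ z)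
    | hsup a b ha hb => exact ha.trans (by rw [GeneratedLattice.val_sup]; exact le_sup_left)
    | hinf a b ha hb => rw [GeneratedLattice.val_inf _ a b]; exact le_inf ha hb
  have htop : ∀ a, GeneratedLattice.val f a ≤ GeneratedLattice.val f (o 0 ⊔ o 1) := by
    intro a
    induction a using GeneratedLattice.induction with
    | hof i =>
      obtain ⟨i⟩ := i
      rw [GeneratedLattice.val_sup]
      fin_cases i
      · exact le_sup_left
      · exact le_sup_right
      · exact (le_sup_left.trans hsup.ge : z ≤ x ⊔ y)
    | hsup a b ha hb => rw [GeneratedLattice.val_sup _ a b]; exact sup_le ha hb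
    | hinf a b ha hb => exact le_trans (by rw [GeneratedLattice.val_inf]; exact inf_le_left) ha
  let B : BoundedOrder (GeneratedLattice f) :=
    { bot := o 0 ⊓ o 1
      top := o 0 ⊔ o 1
      bot_le := hbot
      le_top := htop }
  refine ⟨GeneratedLattice f, inferInstance, B, GeneratedLattice.mem f hM, o 0, o 1, o 2,
    IsCompl.of_eq rfl rfl, IsCompl.of_eq ?_ ?_, hxz⟩
  · exact GeneratedLattice.val_injective f
      ((GeneratedLattice.val_inf f _ _).trans
        (hinf.symm.trans (GeneratedLattice.val_inf f (o 0) (o 1)).symm))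
  · exact GeneratedLattice.val_injective f
      ((GeneratedLattice.val_sup f _ _).trans
        (hsup.symm.trans (GeneratedLattice.val_sup f (o 0) (o 1)).symm))

/-! ### Free triples -/

theorem Cardinal.mk_biUnion_finset_le {X : Type u} {A : Type u} (Φ : A → Finset X) {κ : Cardinal}
    (hκ : ℵ₀ ≤ κ) (hA : #A ≤ κ) : #(⋃ a, (Φ a : Set X) : Set X) ≤ κ := by
  refine (Cardinal.mk_iUnion_le _).trans ?_
  refine (mul_le_mul' hA (ciSup_le' fun a => (Cardinal.lt_aleph0_of_finite _).le)).trans ?_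
  exact (Cardinal.mul_aleph0_eq hκ).le

/-- A special case of Kuratowski's free set theorem. -/
theorem exists_free_triple {X : Type u} (I : Set X) (hI : ℵ_ 2 ≤ #I) (Φ : X → X → Finset X) :
    ∃ i ∈ I, ∃ j ∈ I, ∃ k ∈ I, i ≠ j ∧ i ≠ k ∧ j ≠ k ∧
      k ∉ Φ i j ∧ j ∉ Φ i k ∧ i ∉ Φ j k := by
  have h12 : (ℵ_ 1 : Cardinal.{u}) < ℵ_ 2 := Cardinal.aleph_lt_aleph.2 (by norm_num)
  have h01 : (ℵ₀ : Cardinal.{u}) < ℵ_ 1 := Cardinal.aleph0_lt_aleph_one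
  obtain ⟨A, hAI, hA⟩ := Cardinal.le_mk_iff_exists_subset.1 (h12.le.trans hI)
  -- `A` and the finite sets indexed by `A × A` cover at most ℵ₁ points. The choice of `j` repeats
  -- this one cardinal lower, and `i` has only a finite set to avoid.
  obtain ⟨k, hkI, hkA, hk⟩ : ∃ k ∈ I, k ∉ A ∧ ∀ i ∈ A, ∀ j ∈ A, k ∉ Φ i j := by
    by_contra! h
    have hsub : I ⊆ A ∪ ⋃ p : A × A, (Φ p.1 p.2 : Set X) := by
      intro k hk
      by_cases hkA : k ∈ A
      · exact Or.inl hkA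
      · obtain ⟨i, hi, j, hj, hij⟩ := h k hk hkA
        exact Or.inr (Set.mem_iUnion.2 ⟨(⟨i, hi⟩, ⟨j, hj⟩), hij⟩)
    have h1 : #(A × A) ≤ ℵ_ 1 := by
      rw [← Cardinal.mul_def, hA, Cardinal.mul_eq_self h01.le]
    have h2 := (hI.trans (Cardinal.mk_le_mk_of_subset hsub)).trans (Cardinal.mk_union_le _ _)
    have h3 := h2.trans (add_le_add hA.le
      (Cardinal.mk_biUnion_finset_le (fun p : A × A => Φ p.1 p.2) h01.le h1))
    rw [Cardinal.add_eq_self h01.le] at h3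
    exact h3.not_gt h12
  obtain ⟨B, hBA, hB⟩ := Cardinal.le_mk_iff_exists_subset.1 (h01.le.trans hA.ge)
  obtain ⟨j, hjA, hjB, hj⟩ : ∃ j ∈ A, j ∉ B ∧ ∀ i ∈ B, j ∉ Φ i k := by
    by_contra! h
    have hsub : A ⊆ B ∪ ⋃ i : B, (Φ i k : Set X) := by
      intro j hj
      by_cases hjB : j ∈ B
      · exact Or.inl hjB
      · obtain ⟨i, hi, hij⟩ := h j hj hjB
        exact Or.inr (Set.mem_iUnion.2 ⟨⟨i, hi⟩, hij⟩)
    have h2 := (hA.ge.trans (Cardinal.mk_le_mk_of_subset hsub)).trans (Cardinal.mk_union_le _ _)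
    have h3 := h2.trans (add_le_add hB.le
      (Cardinal.mk_biUnion_finset_le (fun i : B => Φ i k) le_rfl hB.le))
    rw [Cardinal.add_eq_self le_rfl] at h3
    exact h3.not_gt h01
  have hBinf : B.Infinite := Cardinal.infinite_iff.2 hB.ge |> Set.infinite_coe_iff.1
  obtain ⟨i, hi, hij⟩ := hBinf.exists_notMem_finset (Φ j k)
  refine ⟨i, hAI (hBA hi), j, hAI hjA, k, hkI, ?_, ?_, ?_, hk i (hBA hi) j hjA, hj i hi, hij⟩
  · rintro rfl; exact hjB hi
  · rintro rfl; exact hkA (hBA hi)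
  · rintro rfl; exact hkA hjA

/-! ### Congruences of free lattices -/

namespace LatticeCon

variable {F : Type u} [Lattice F]

/-- The principal congruence generated by a pair, as a compact congruence. -/
noncomputable abbrev theta (x y : F) : Conc F := (LatticeCon.isRelRep F).dist x y

theorem theta_le {x y : F} {c : Conc F} : theta x y ≤ c ↔ c.1.r x y :=
  (LatticeCon.isRelRep F).dist_le

theorem theta_le_ker {L : Type v} [Lattice L] {g : LatticeHom F L} {x y : F} :
    (theta x y).1 ≤ ker g ↔ g x = g y :=
  (LatticeCon.isRelRep F).theta_le

theorem sup_le_ker {L : Type v} [Lattice L] {g : LatticeHom F L} {a b : Conc F} :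
    (a ⊔ b).1 ≤ ker g ↔ a.1 ≤ ker g ∧ b.1 ≤ ker g :=
  sup_le_iff (a := a.1) (b := b.1)

theorem finset_sup_le {ι : Type v} {t : Finset ι} {f : ι → Conc F} {d : LatticeCon F} :
    (t.sup f).1 ≤ d ↔ ∀ i ∈ t, (f i).1 ≤ d := by
  classical
  induction t using Finset.induction_on with
  | empty => exact ⟨fun _ _ h => absurd h (Finset.notMem_empty _), fun _ => (bot_le : ⊥ ≤ d)⟩
  | insert a s ha ih =>
    rw [Finset.sup_insert, Finset.forall_mem_insert, ← ih]
    exact sup_le_iff (a := (f a).1) (b := (s.sup f).1)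

end LatticeCon

namespace LatticeVariety.IsFreeOver

variable {V : LatticeVariety} {X F : Type u} [Lattice F] {ι : X → F} {C₀ C₁ : Set F}
  (h : V.IsFreeOver ι C₀ C₁)
include h

/-- The homomorphism from `F` extending an assignment of the generators. -/
noncomputable def hom {L : Type u} [Lattice L] [BoundedOrder L] (hL : V.Mem L) (f : X → L) :
    LatticeHom F L := (h.lift L hL f).choose

theorem hom_of {L : Type u} [Lattice L] [BoundedOrder L] (hL : V.Mem L) (f : X → L) (x : X) :
    h.hom hL f (ι x) = f x := (h.lift L hL f).choose_spec.1 x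

theorem hom_bot {L : Type u} [Lattice L] [BoundedOrder L] (hL : V.Mem L) (f : X → L) {c : F}
    (hc : c ∈ C₀) : h.hom hL f c = ⊥ := (h.lift L hL f).choose_spec.2.1 c hc

theorem hom_top {L : Type u} [Lattice L] [BoundedOrder L] (hL : V.Mem L) (f : X → L) {c : F}
    (hc : c ∈ C₁) : h.hom hL f c = ⊤ := (h.lift L hL f).choose_spec.2.2 c hc

/-- An element is built from finitely many generators; the constants contribute none, since their
images are prescribed. -/
theorem exists_support (a : F) : ∃ s : Finset X, ∀ (L : Type u) [Lattice L] [BoundedOrder L]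
    (hL : V.Mem L) (f g : X → L), (∀ x ∈ s, f x = g x) → h.hom hL f a = h.hom hL g a := by
  classical
  revert a
  refine h.induction _ (fun x => ⟨{x}, fun L _ _ hL f g hfg => ?_⟩)
    (fun c hc => ⟨∅, fun L _ _ hL f g _ => by rw [h.hom_bot hL f hc, h.hom_bot hL g hc]⟩)
    (fun c hc => ⟨∅, fun L _ _ hL f g _ => by rw [h.hom_top hL f hc, h.hom_top hL g hc]⟩) ?_ ?_
  · rw [h.hom_of, h.hom_of, hfg x (by simp)]
  all_goals
    rintro a b ⟨s, hs⟩ ⟨t, ht⟩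
    refine ⟨s ∪ t, fun L _ _ hL f g hfg => ?_⟩
  · rw [map_sup, map_sup, hs L hL f g fun x hx => hfg x (Finset.mem_union_left _ hx),
      ht L hL f g fun x hx => hfg x (Finset.mem_union_right _ hx)]
  · rw [map_inf, map_inf, hs L hL f g fun x hx => hfg x (Finset.mem_union_left _ hx),
      ht L hL f g fun x hx => hfg x (Finset.mem_union_right _ hx)]

theorem exists_support_con (c : Conc F) : ∃ s : Finset X, ∀ (L : Type u) [Lattice L]
    [BoundedOrder L] (hL : V.Mem L) (f g : X → L), (∀ x ∈ s, f x = g x) →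
      c.1 ≤ LatticeCon.ker (h.hom hL f) → c.1 ≤ LatticeCon.ker (h.hom hL g) := by
  classical
  choose s hs using h.exists_support
  obtain ⟨t, rfl⟩ := (LatticeCon.isRelRep F).exists_eq_sup_dist c
  refine ⟨t.biUnion fun p => s p.1 ∪ s p.2, fun L _ _ hL f g hfg hle => ?_⟩
  rw [LatticeCon.finset_sup_le] at hle ⊢
  intro p hp
  have h1 := hs p.1 L hL f g fun x hx => hfg x (Finset.mem_biUnion.2 ⟨p, hp, by simp [hx]⟩)
  have h2 := hs p.2 L hL f g fun x hx => hfg x (Finset.mem_biUnion.2 ⟨p, hp, by simp [hx]⟩)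
  exact LatticeCon.theta_le_ker.2 (h1 ▸ h2 ▸ LatticeCon.theta_le_ker.1 (hle p hp))

/-- An inclusion between kernels obtained from a sublattice of `L × L × L`. -/
theorem ker_inf_ker_le {L : Type u} [Lattice L] [BoundedOrder L] (hL : V.Mem L) {x y : L}
    (hxy : IsCompl x y) {f f₁ f₂ : X → L}
    (hf : ∀ i, (f₁ i = ⊥ ∧ f₂ i = ⊥ ∧ f i = ⊥) ∨ (f₁ i = ⊤ ∧ f₂ i = ⊥ ∧ f i = x) ∨
      (f₁ i = ⊥ ∧ f₂ i = ⊤ ∧ f i = y) ∨ (f₁ i = ⊤ ∧ f₂ i = ⊤ ∧ f i = ⊤)) {c : LatticeCon F}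
    (h₁ : c ≤ LatticeCon.ker (h.hom hL f₁)) (h₂ : c ≤ LatticeCon.ker (h.hom hL f₂)) :
    c ≤ LatticeCon.ker (h.hom hL f) := by
  have hinf := hxy.inf_eq_bot
  have hsup := hxy.sup_eq_top
  have hinf' := hxy.symm.inf_eq_bot
  have hsup' := hxy.symm.sup_eq_top
  set g := h.hom hL f with hg
  set g₁ := h.hom hL f₁ with hg₁
  set g₂ := h.hom hL f₂ with hg₂
  have key : ∀ a, (g₁ a = ⊥ ∧ g₂ a = ⊥ ∧ g a = ⊥) ∨ (g₁ a = ⊤ ∧ g₂ a = ⊥ ∧ g a = x) ∨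
      (g₁ a = ⊥ ∧ g₂ a = ⊤ ∧ g a = y) ∨ (g₁ a = ⊤ ∧ g₂ a = ⊤ ∧ g a = ⊤) := by
    refine h.induction _ (fun i => ?_) (fun c hc => ?_) (fun c hc => ?_) ?_ ?_
    · simpa only [hg, hg₁, hg₂, h.hom_of] using hf i
    · exact Or.inl ⟨h.hom_bot hL _ hc, h.hom_bot hL _ hc, h.hom_bot hL _ hc⟩
    · exact Or.inr (Or.inr (Or.inr ⟨h.hom_top hL _ hc, h.hom_top hL _ hc, h.hom_top hL _ hc⟩))
    all_goals
      rintro a b (⟨p1, p2, p3⟩ | ⟨p1, p2, p3⟩ | ⟨p1, p2, p3⟩ | ⟨p1, p2, p3⟩)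
        (⟨q1, q2, q3⟩ | ⟨q1, q2, q3⟩ | ⟨q1, q2, q3⟩ | ⟨q1, q2, q3⟩) <;>
      simp [p1, p2, p3, q1, q2, q3, hinf, hsup, hinf', hsup']
  -- The values of `g` lie in the Boolean square `{⊥, x, y, ⊤}`, with `g₁` and `g₂` as coordinates;
  -- so `g` is recovered from them.
  have hg : ∀ a, g a = x ⊓ g₁ a ⊔ y ⊓ g₂ a := by
    intro a
    rcases key a with ⟨p1, p2, p3⟩ | ⟨p1, p2, p3⟩ | ⟨p1, p2, p3⟩ | ⟨p1, p2, p3⟩ <;>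
      simp [p1, p2, p3, hsup]
  intro a b hab
  have e1 : g₁ a = g₁ b := h₁ hab
  have e2 : g₂ a = g₂ b := h₂ hab
  change g a = g b
  rw [hg, hg, e1, e2]

/-- An inclusion between kernels obtained from a prime filter. -/
theorem ker_le_ker_of_not_le {L : Type u} [Lattice L] [BoundedOrder L] (hL : V.Mem L) {x z : L}
    (hxz : ¬ x ≤ z) {f f₁ : X → L}
    (hf : ∀ i, (f₁ i = ⊤ ∧ x ≤ f i) ∨ (f₁ i = ⊥ ∧ f i ≤ z)) :
    LatticeCon.ker (h.hom hL f) ≤ LatticeCon.ker (h.hom hL f₁) := by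
  have key : ∀ a, (h.hom hL f₁ a = ⊤ ∧ x ≤ h.hom hL f a) ∨
      (h.hom hL f₁ a = ⊥ ∧ h.hom hL f a ≤ z) := by
    refine h.induction _ (fun i => ?_) (fun c hc => ?_) (fun c hc => ?_) ?_ ?_
    · simpa only [h.hom_of] using hf i
    · exact Or.inr ⟨h.hom_bot hL _ hc, (h.hom_bot hL _ hc).trans_le bot_le⟩
    · exact Or.inl ⟨h.hom_top hL _ hc, le_top.trans (h.hom_top hL _ hc).ge⟩
    · rintro a b (⟨p1, p2⟩ | ⟨p1, p2⟩) (⟨q1, q2⟩ | ⟨q1, q2⟩) <;> rw [map_sup, map_sup, p1, q1]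
      · exact Or.inl ⟨by simp, le_sup_of_le_left p2⟩
      · exact Or.inl ⟨by simp, le_sup_of_le_left p2⟩
      · exact Or.inl ⟨by simp, le_sup_of_le_right q2⟩
      · exact Or.inr ⟨by simp, sup_le p2 q2⟩
    · rintro a b (⟨p1, p2⟩ | ⟨p1, p2⟩) (⟨q1, q2⟩ | ⟨q1, q2⟩) <;> rw [map_inf, map_inf, p1, q1]
      · exact Or.inl ⟨by simp, le_inf p2 q2⟩
      · exact Or.inr ⟨by simp, inf_le_of_right_le q2⟩
      · exact Or.inr ⟨by simp, inf_le_of_left_le p2⟩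
      · exact Or.inr ⟨by simp, inf_le_of_left_le p2⟩
  intro a b hab
  have e : h.hom hL f a = h.hom hL f b := hab
  change h.hom hL f₁ a = h.hom hL f₁ b
  rcases key a with ⟨p1, p2⟩ | ⟨p1, p2⟩ <;> rcases key b with ⟨q1, q2⟩ | ⟨q1, q2⟩
  · rw [p1, q1]
  · exact absurd (p2.trans (e.le.trans q2)) hxz
  · exact absurd (q2.trans (e.ge.trans p2)) hxz
  · rw [p1, q1]

end LatticeVariety.IsFreeOver

/-! ### Uniform refinements -/

/-- A uniform refinement of the decompositions `e ≤ a i ⊔ b i` over the index set `I`. -/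
structure IsUniformRefinement {S : Type u} [SemilatticeSup S] {X : Type v} (e : S) (a b : X → S)
    (I : Set X) (c : X → X → S) : Prop where
  symm : ∀ i j, c i j = c j i
  le_left : ∀ i ∈ I, ∀ j ∈ I, c i j ≤ a i ⊔ a j
  le_right : ∀ i ∈ I, ∀ j ∈ I, c i j ≤ b i ⊔ b j
  le_sup : ∀ i ∈ I, ∀ j ∈ I, e ≤ a j ⊔ b i ⊔ c i j
  triangle : ∀ i j k, c i k ≤ c i j ⊔ c j k

/-- Write `e` as a finite join of distances and split each at a point `z i p`. The bounds on `c i j`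
follow from paths through these points, provided `i` and `j` use the two alternatives of type `3/2`
in the same way. -/
theorem IsVDistanceThreeHalves.exists_isUniformRefinement {S : Type u} [SemilatticeSup S]
    [OrderBot S] {Y : Type v} {δ : Y → Y → S} (hδ : IsVDistanceThreeHalves δ)
    (hgen : RangeJoinGenerates δ) {X : Type w} (hX : ℵ_ 2 ≤ #X) {e : S} {a b : X → S}
    (he : ∀ i, e ≤ a i ⊔ b i) :
    ∃ (I : Set X) (c : X → X → S), ℵ_ 2 ≤ #I ∧ IsUniformRefinement e a b I c := by
  classical
  obtain ⟨t, rfl⟩ := hgen e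
  have hex : ∀ (i : X) (p : t), ∃ z, (δ p.1.1 z ≤ a i ∧ δ z p.1.2 ≤ b i) ∨
      (δ p.1.1 z ≤ b i ∧ δ z p.1.2 ≤ a i) := fun i p => hδ.v_condition _ _ _ _
    ((Finset.le_sup (f := fun p : Y × Y => δ p.1 p.2) p.2).trans (he i))
  choose z hz using hex
  -- The colour of `i` records for which pairs the first alternative holds. There are finitely many
  -- colours and ℵ₂ is regular, so one colour class has size at least ℵ₂.
  let χ : X → ULift.{w} (Fin t.card → Prop) := fun i => ⟨fun n =>
    δ (t.equivFin.symm n).1.1 (z i (t.equivFin.symm n)) ≤ a i ∧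
      δ (z i (t.equivFin.symm n)) (t.equivFin.symm n).1.2 ≤ b i⟩
  have hreg : (ℵ_ 2 : Cardinal.{w}).IsRegular := by
    have := Cardinal.isRegular_aleph_add_one 1
    rwa [one_add_one_eq_two] at this
  obtain ⟨o, ho⟩ := Cardinal.infinite_pigeonhole_card χ (ℵ_ 2) hX hreg.aleph0_le
    (by
      rw [hreg.cof_ord]
      exact (Cardinal.lt_aleph0_of_finite _).trans_le hreg.aleph0_le)
  have hcl : ∀ i ∈ χ ⁻¹' {o}, ∀ j ∈ χ ⁻¹' {o}, ∀ p : t,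
      ((δ p.1.1 (z i p) ≤ a i ∧ δ (z i p) p.1.2 ≤ b i) ∧
        (δ p.1.1 (z j p) ≤ a j ∧ δ (z j p) p.1.2 ≤ b j)) ∨
      ((δ p.1.1 (z i p) ≤ b i ∧ δ (z i p) p.1.2 ≤ a i) ∧
        (δ p.1.1 (z j p) ≤ b j ∧ δ (z j p) p.1.2 ≤ a j)) := by
    intro i hi j hj p
    have h1 : χ i = χ j := hi.trans hj.symm
    have h2 := congrFun (congrArg ULift.down h1) (t.equivFin p)
    simp only [χ, Equiv.symm_apply_apply] at h2
    rcases hz i p with h | h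
    · exact Or.inl ⟨h, h2.mp h⟩
    · by_cases h3 : δ p.1.1 (z i p) ≤ a i ∧ δ (z i p) p.1.2 ≤ b i
      · exact Or.inl ⟨h3, h2.mp h3⟩
      · exact Or.inr ⟨h, (hz j p).resolve_left fun h4 => h3 (h2.mpr h4)⟩
  have tri : ∀ {x y w : Y} {s s' : S}, δ x y ≤ s → δ y w ≤ s' → δ x w ≤ s ⊔ s' :=
    fun h1 h2 => (hδ.triangle _ _ _).trans (sup_le_sup h1 h2)
  have sy : ∀ {x y : Y} {s : S}, δ x y ≤ s → δ y x ≤ s := fun h => (hδ.symm _ _).trans_le h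
  refine ⟨_, fun i j => Finset.univ.sup fun p : t => δ (z i p) (z j p), ho, ?_, ?_, ?_, ?_, ?_⟩
  · intro i j
    simp only [hδ.symm]
  · intro i hi j hj
    refine Finset.sup_le fun p _ => ?_
    rcases hcl i hi j hj p with ⟨h1, h2⟩ | ⟨h1, h2⟩
    · exact tri (sy h1.1) h2.1
    · exact tri h1.2 (sy h2.2)
  · intro i hi j hj
    refine Finset.sup_le fun p _ => ?_
    rcases hcl i hi j hj p with ⟨h1, h2⟩ | ⟨h1, h2⟩
    · exact tri h1.2 (sy h2.2)
    · exact tri (sy h1.1) h2.1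
  · intro i hi j hj
    refine Finset.sup_le fun p hp => ?_
    have hle : δ (z i ⟨p, hp⟩) (z j ⟨p, hp⟩) ≤ Finset.univ.sup fun p : t => δ (z i p) (z j p) :=
      Finset.le_sup (f := fun p : t => δ (z i p) (z j p)) (Finset.mem_univ _)
    rcases hcl i hi j hj ⟨p, hp⟩ with ⟨h1, h2⟩ | ⟨h1, h2⟩
    · exact (tri (tri h2.1 (sy hle)) h1.2).trans
        (sup_le (sup_le (le_sup_of_le_left le_sup_left) le_sup_right)
          (le_sup_of_le_left le_sup_right))
    · exact (tri (tri h1.1 hle) h2.2).trans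
        (sup_le (sup_le (le_sup_of_le_left le_sup_right) le_sup_right)
          (le_sup_of_le_left le_sup_left))
  · intro i j k
    refine Finset.sup_le fun p hp => tri (y := z j p) ?_ ?_
    · exact Finset.le_sup (f := fun p : t => δ (z i p) (z j p)) hp
    · exact Finset.le_sup (f := fun p : t => δ (z j p) (z k p)) hp

/-! ### Refuting uniform refinements in free lattices -/

namespace LatticeVariety.IsFreeOver

variable {V : LatticeVariety} {X F : Type u} [Lattice F] {ι : X → F} {C₀ C₁ : Set F}
  (h : V.IsFreeOver ι C₀ C₁)

/-- The assignment of the generators given by a family of pairs, where the generators are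
indexed by two copies of `X` and two further generators that are sent to the bounds. -/
noncomputable def pairAssignment {L : Type u} [Lattice L] [BoundedOrder L]
    (ψ : X ⊕ X ⊕ Bool ↪ X) (φ : X → L × L) : X → L :=
  Function.extend ψ (Sum.elim (fun i => (φ i).1) (Sum.elim (fun i => (φ i).2)
    fun b => if b then ⊤ else ⊥)) fun _ => ⊥

section

variable {L : Type u} [Lattice L] [BoundedOrder L] (ψ : X ⊕ X ⊕ Bool ↪ X)

theorem pairAssignment_apply (φ : X → L × L) (m : X ⊕ X ⊕ Bool) :
    pairAssignment ψ φ (ψ m) = Sum.elim (fun i => (φ i).1) (Sum.elim (fun i => (φ i).2)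
      fun b => if b then ⊤ else ⊥) m := ψ.injective.extend_apply _ _ m

/-- Both bounds occur as images of the two extra generators, and `⊥` is also the default value off
the range of `ψ`. -/
theorem pairAssignment_rel (R : L → L → L → Prop) (hbot : R ⊥ ⊥ ⊥) (htop : R ⊤ ⊤ ⊤)
    {φ₁ φ₂ φ : X → L × L} (hfst : ∀ i, R (φ₁ i).1 (φ₂ i).1 (φ i).1)
    (hsnd : ∀ i, R (φ₁ i).2 (φ₂ i).2 (φ i).2) (x : X) :
    R (pairAssignment ψ φ₁ x) (pairAssignment ψ φ₂ x) (pairAssignment ψ φ x) := by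
  by_cases hx : ∃ m, ψ m = x
  · obtain ⟨m, rfl⟩ := hx
    simp only [pairAssignment_apply]
    rcases m with i | i | b
    · exact hfst i
    · exact hsnd i
    · cases b
      · exact hbot
      · exact htop
  · simpa only [pairAssignment, Function.extend_apply' _ _ _ hx] using hbot

include h in
theorem exists_index_support (c : Conc F) : ∃ s : Finset X, ∀ (L : Type u) [Lattice L]
    [BoundedOrder L] (hL : V.Mem L) (φ φ' : X → L × L), (∀ i ∈ s, φ i = φ' i) →
      c.1 ≤ LatticeCon.ker (h.hom hL (pairAssignment ψ φ)) →
      c.1 ≤ LatticeCon.ker (h.hom hL (pairAssignment ψ φ')) := by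
  classical
  obtain ⟨s, hs⟩ := h.exists_support_con c
  refine ⟨s.preimage (fun i => ψ (Sum.inl i)) (ψ.injective.comp Sum.inl_injective).injOn ∪
    s.preimage (fun i => ψ (Sum.inr (Sum.inl i)))
      (ψ.injective.comp (Sum.inr_injective.comp Sum.inl_injective)).injOn,
    fun L _ _ hL φ φ' hφ => hs L hL _ _ fun x hx => ?_⟩
  by_cases hm : ∃ m, ψ m = x
  · obtain ⟨m, rfl⟩ := hm
    simp only [pairAssignment_apply]
    rcases m with i | i | b
    · exact congrArg Prod.fst (hφ i (Finset.mem_union_left _ (Finset.mem_preimage.2 hx)))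
    · exact congrArg Prod.snd (hφ i (Finset.mem_union_right _ (Finset.mem_preimage.2 hx)))
    · rfl
  · simp only [pairAssignment, Function.extend_apply' _ _ _ hm]

variable (ι)

/-- The outer congruences of the decompositions of `decomposed`. -/
noncomputable def outer (i : X) : Conc F :=
  LatticeCon.theta (ι (ψ (.inr (.inr false)))) (ι (ψ (.inl i))) ⊔
    LatticeCon.theta (ι (ψ (.inr (.inl i)))) (ι (ψ (.inr (.inr true))))

/-- The inner congruences of the decompositions of `decomposed`. -/
noncomputable def inner (i : X) : Conc F :=
  LatticeCon.theta (ι (ψ (.inl i))) (ι (ψ (.inr (.inl i))))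

/-- The congruence generated by the pair of the two distinguished generators. -/
noncomputable def decomposed : Conc F :=
  LatticeCon.theta (ι (ψ (.inr (.inr false)))) (ι (ψ (.inr (.inr true))))

theorem decomposed_le (i : X) : decomposed ι ψ ≤ outer ι ψ i ⊔ inner ι ψ i := by
  rw [decomposed, LatticeCon.theta_le]
  have h1 : LatticeCon.theta _ _ ≤ outer ι ψ i ⊔ inner ι ψ i := le_sup_left.trans le_sup_left
  have h2 : LatticeCon.theta _ _ ≤ outer ι ψ i ⊔ inner ι ψ i := le_sup_right.trans le_sup_left
  have h3 : LatticeCon.theta _ _ ≤ outer ι ψ i ⊔ inner ι ψ i := le_sup_right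
  exact Setoid.trans' _ (Setoid.trans' _ (LatticeCon.theta_le.1 h1) (LatticeCon.theta_le.1 h3))
    (LatticeCon.theta_le.1 h2)

variable {ι} (hL : V.Mem L) {φ : X → L × L} {i : X}

theorem outer_le_ker : (outer ι ψ i).1 ≤ LatticeCon.ker (h.hom hL (pairAssignment ψ φ)) ↔
    φ i = (⊥, ⊤) := by
  rw [outer, LatticeCon.sup_le_ker, LatticeCon.theta_le_ker, LatticeCon.theta_le_ker]
  simp [hom_of, pairAssignment_apply, Prod.ext_iff, eq_comm]

theorem inner_le_ker : (inner ι ψ i).1 ≤ LatticeCon.ker (h.hom hL (pairAssignment ψ φ)) ↔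
    (φ i).1 = (φ i).2 := by
  rw [inner, LatticeCon.theta_le_ker]
  simp [hom_of, pairAssignment_apply]

theorem decomposed_le_ker :
    (decomposed ι ψ).1 ≤ LatticeCon.ker (h.hom hL (pairAssignment ψ φ)) ↔ (⊥ : L) = ⊤ := by
  rw [decomposed, LatticeCon.theta_le_ker]
  simp [hom_of, pairAssignment_apply]

-- The two coordinates of the Boolean square `{⊥, x, y, ⊤}` give two assignments: one collapses both
-- inner congruences, the other both outer ones. As `c i j` lies below each of these joins, it is in
-- both kernels.
open Classical in
theorem refinement_le_ker {I : Set X} {c : X → X → Conc F}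
    (hc : IsUniformRefinement (decomposed ι ψ) (outer ι ψ) (inner ι ψ) I c) {x y : L}
    (hxy : IsCompl x y) {i j : X} (hi : i ∈ I) (hj : j ∈ I) (hij : i ≠ j) :
    (c i j).1 ≤ LatticeCon.ker (h.hom hL (pairAssignment ψ fun m =>
      if m = i then (x, ⊤) else if m = j then (⊥, y) else (⊥, ⊤))) := by
  refine h.ker_inf_ker_le hL hxy (f₁ := pairAssignment ψ fun m =>
      if m = i then (⊤, ⊤) else if m = j then (⊥, ⊥) else (⊥, ⊤))
    (f₂ := pairAssignment ψ fun _ => (⊥, ⊤))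
    (pairAssignment_rel ψ (fun a₁ a₂ a => (a₁ = ⊥ ∧ a₂ = ⊥ ∧ a = ⊥) ∨ (a₁ = ⊤ ∧ a₂ = ⊥ ∧ a = x) ∨
      (a₁ = ⊥ ∧ a₂ = ⊤ ∧ a = y) ∨ (a₁ = ⊤ ∧ a₂ = ⊤ ∧ a = ⊤)) (by simp) (by simp) ?_ ?_) ?_ ?_
  · intro m
    dsimp only
    split_ifs <;> simp
  · intro m
    dsimp only
    split_ifs <;> simp
  · refine le_trans (hc.le_right i hi j hj : (c i j).1 ≤ (inner ι ψ i ⊔ inner ι ψ j).1) ?_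
    rw [LatticeCon.sup_le_ker, inner_le_ker, inner_le_ker]
    simp [hij.symm]
  · refine le_trans (hc.le_left i hi j hj : (c i j).1 ≤ (outer ι ψ i ⊔ outer ι ψ j).1) ?_
    rw [LatticeCon.sup_le_ker, outer_le_ker, outer_le_ker]
    simp

end

include h

theorem not_isUniformRefinement (hV : LatticeVariety.IsNonDistributive.{w} V)
    (ψ : X ⊕ X ⊕ Bool ↪ X) {I : Set X} (hI : ℵ_ 2 ≤ #I) {c : X → X → Conc F} :
    ¬ IsUniformRefinement (decomposed ι ψ) (outer ι ψ) (inner ι ψ) I c := by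
  classical
  intro hc
  obtain ⟨L, _, _, hL, x, y, z, hxy, hzy, hxz⟩ := hV.exists_complements
  choose Φ hΦ using fun i j => h.exists_index_support ψ (c i j)
  obtain ⟨i, hi, j, hj, k, hk, hij, hik, hjk, hkΦ, hjΦ, hiΦ⟩ := exists_free_triple I hI Φ
  let φ : X → L × L := fun m => if m = i then (x, ⊤) else if m = j then (⊥, y) else
    if m = k then (z, ⊤) else (⊥, ⊤)
  have hcij : (c i j).1 ≤ LatticeCon.ker (h.hom hL (pairAssignment ψ φ)) := by
    refine hΦ i j L hL _ _ (fun m hm => ?_) (h.refinement_le_ker ψ hL hc hxy hi hj hij)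
    have : m ≠ k := ne_of_mem_of_not_mem hm hkΦ
    simp [φ, this]
  -- Same argument with the complement `z` in place of `x`, for the pair `(k, j)`; symmetry of `c`
  -- restores the order.
  have hcjk : (c j k).1 ≤ LatticeCon.ker (h.hom hL (pairAssignment ψ φ)) := by
    refine hΦ j k L hL _ _ (fun m hm => ?_)
      (hc.symm j k ▸ h.refinement_le_ker ψ hL hc hzy hk hj hjk.symm)
    have : m ≠ i := ne_of_mem_of_not_mem hm hiΦ
    by_cases hmk : m = k
    · subst hmk
      simp [φ, this, hjk.symm]
    · simp [φ, this, hmk]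
  have hcik : (c i k).1 ≤ LatticeCon.ker (h.hom hL (pairAssignment ψ φ)) :=
    le_trans (hc.triangle i j k : (c i k).1 ≤ (c i j ⊔ c j k).1)
      (LatticeCon.sup_le_ker.2 ⟨hcij, hcjk⟩)
  -- Since `j` is outside the support of `c i k`, its pair may be reset to the default, which
  -- removes `y` from the picture.
  have hcik' : (c i k).1 ≤ LatticeCon.ker (h.hom hL (pairAssignment ψ fun m =>
      if m = i then (x, ⊤) else if m = k then (z, ⊤) else (⊥, ⊤))) := by
    refine hΦ i k L hL _ _ (fun m hm => ?_) hcik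
    have : m ≠ j := ne_of_mem_of_not_mem hm hjΦ
    simp [φ, this]
  -- Elements above `x` go to `⊤` and those below `z` to `⊥`: thus `(x, ⊤)` becomes `(⊤, ⊤)` and
  -- `(z, ⊤)` becomes `(⊥, ⊤)`.
  let φ' : X → L × L := fun m => if m = i then (⊤, ⊤) else (⊥, ⊤)
  have hker := h.ker_le_ker_of_not_le hL hxz
    (pairAssignment_rel ψ (fun a₁ _ a => (a₁ = ⊤ ∧ x ≤ a) ∨ (a₁ = ⊥ ∧ a ≤ z)) (by simp) (by simp)
      (φ₁ := φ') (φ₂ := φ') (φ := fun m =>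
      if m = i then (x, ⊤) else if m = k then (z, ⊤) else (⊥, ⊤))
      (by intro m; dsimp only [φ']; split_ifs <;> simp)
      (by intro m; dsimp only [φ']; split_ifs <;> simp))
  have hle : (decomposed ι ψ).1 ≤ LatticeCon.ker (h.hom hL (pairAssignment ψ φ')) := by
    refine le_trans (hc.le_sup i hi k hk :
      (decomposed ι ψ).1 ≤ (outer ι ψ k ⊔ inner ι ψ i ⊔ c i k).1) ?_
    rw [LatticeCon.sup_le_ker, LatticeCon.sup_le_ker, outer_le_ker, inner_le_ker]
    exact ⟨⟨by simp [φ', hik.symm], by simp [φ']⟩, hcik'.trans hker⟩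
  rw [decomposed_le_ker] at hle
  have := subsingleton_of_bot_eq_top hle
  exact hxz (Subsingleton.elim x z).le

/-- There is no join-generating distance of type `3/2` on a free lattice with at least `ℵ₂`
generators in a non-distributive variety. -/
theorem not_isVDistanceThreeHalves (hV : LatticeVariety.IsNonDistributive.{w} V)
    (hX : ℵ_ 2 ≤ #X) {Y : Type v} (δ : Y → Y → Conc F) :
    ¬ (IsVDistanceThreeHalves δ ∧ RangeJoinGenerates δ) := by
  rintro ⟨hδ, hgen⟩
  have hX' : ℵ₀ ≤ #X := (Cardinal.aleph0_le_aleph 2).trans hX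
  obtain ⟨ψ⟩ : Nonempty (X ⊕ X ⊕ Bool ↪ X) := by
    rw [← Cardinal.le_def]
    have h2 : Cardinal.lift.{u} #Bool ≤ #X := (Cardinal.lift_lt_aleph0.2
      (Cardinal.lt_aleph0_of_finite _)).le.trans hX'
    rw [Cardinal.mk_sum, Cardinal.mk_sum]
    simpa using Cardinal.add_le_of_le hX' le_rfl (Cardinal.add_le_of_le hX' le_rfl (by simpa using h2))
  obtain ⟨I, c, hI, hc⟩ := hδ.exists_isUniformRefinement hgen hX (decomposed_le ι ψ)
  exact h.not_isUniformRefinement hV ψ hI hc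

/-- The congruence lattice of such a free lattice is not represented by almost permuting
equivalence relations. -/
theorem isEmpty_orderIso (hV : LatticeVariety.IsNonDistributive.{w} V) (hX : ℵ_ 2 ≤ #X)
    {P : Type v} [PartialOrder P] {Y : Type*} {r : P → Y → Y → Prop} (hr : IsRelRep r)
    (hp : IsAlmostPermutable r) : IsEmpty (LatticeCon F ≃o P) :=
  ⟨fun e => h.not_isVDistanceThreeHalves hV hX (hr.comp e).dist
    ⟨(hr.comp e).isVDistanceThreeHalves_dist (hp.comp e), (hr.comp e).rangeJoinGenerates_dist⟩⟩

end LatticeVariety.IsFreeOver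

/-! ### Counting compact congruences -/

/-- A lattice generated by at most `κ` elements has at most `κ` elements, for `κ` infinite. -/
theorem Lattice.mk_le_of_induction {F : Type u} [Lattice F] {S : Set F} {κ : Cardinal.{u}}
    (hκ : ℵ₀ ≤ κ) (hS : #S ≤ κ)
    (h : ∀ p : F → Prop, (∀ a ∈ S, p a) → (∀ a b, p a → p b → p (a ⊔ b)) →
      (∀ a b, p a → p b → p (a ⊓ b)) → ∀ a, p a) : #F ≤ κ := by
  let T : ℕ → Set F := fun n => Nat.rec S
    (fun _ T => T ∪ (Set.image2 (· ⊔ ·) T T ∪ Set.image2 (· ⊓ ·) T T)) n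
  have hT : ∀ n, T (n + 1) = T n ∪ (Set.image2 (· ⊔ ·) (T n) (T n) ∪
    Set.image2 (· ⊓ ·) (T n) (T n)) := fun _ => rfl
  have hmono : Monotone T := monotone_nat_of_le_succ fun n => by
    rw [hT]; exact Set.subset_union_left
  have hcard : ∀ n, #↥(T n) ≤ κ := by
    intro n
    induction n with
    | zero => exact hS
    | succ n ih =>
      have himg : ∀ f : F → F → F, #↥(Set.image2 f (T n) (T n)) ≤ κ := by
        intro f
        rw [← Set.image_prod]
        refine Cardinal.mk_image_le.trans ?_
        rw [Cardinal.mk_congr (Equiv.Set.prod (T n) (T n)), ← Cardinal.mul_def]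
        exact (mul_le_mul' ih ih).trans (Cardinal.mul_eq_self hκ).le
      rw [hT]
      exact (Cardinal.mk_union_le _ _).trans (Cardinal.add_le_of_le hκ ih
        ((Cardinal.mk_union_le _ _).trans (Cardinal.add_le_of_le hκ (himg _) (himg _))))
  have huniv : ⋃ n, T n = Set.univ := by
    refine Set.eq_univ_of_forall fun a => Set.mem_iUnion.2 ?_
    revert a
    refine h _ (fun a ha => ⟨0, ha⟩) ?_ ?_
    all_goals
      rintro a b ⟨m, ha⟩ ⟨n, hb⟩
      have ha' := hmono (le_max_left m n) ha
      have hb' := hmono (le_max_right m n) hb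
      refine ⟨max m n + 1, ?_⟩
      rw [hT]
    · exact Or.inr (Or.inl ⟨a, ha', b, hb', rfl⟩)
    · exact Or.inr (Or.inr ⟨a, ha', b, hb', rfl⟩)
  rw [← Cardinal.mk_univ, ← huniv]
  have h1 := Cardinal.mk_iUnion_le_lift T
  rw [Cardinal.lift_id'.{0, u}, Cardinal.mk_nat, Cardinal.lift_aleph0] at h1
  refine h1.trans ((mul_le_mul' hκ (ciSup_le' fun n => ?_)).trans (Cardinal.mul_eq_self hκ).le)
  exact (Cardinal.lift_id'.{0, u} _).trans_le (hcard n)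

theorem LatticeVariety.IsFreeOver.mk_conc {V : LatticeVariety} {X F : Type u} [Lattice F]
    {ι : X → F} {C₀ C₁ : Set F} (h : V.IsFreeOver ι C₀ C₁)
    (hV : LatticeVariety.IsNonDistributive.{w} V) (hX : ℵ₀ ≤ #X) (h₀ : C₀.Countable)
    (h₁ : C₁.Countable) : #(Conc F) = #X := by
  classical
  have : Infinite X := Cardinal.infinite_iff.2 hX
  obtain ⟨L, _, _, hL, x, y, z, hxy, hzy, hxz⟩ := hV.exists_complements
  have hne : (⊥ : L) ≠ ⊤ := fun hbt => by
    have := subsingleton_of_bot_eq_top hbt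
    exact hxz (Subsingleton.elim x z).le
  let x₀ : X := Classical.arbitrary X
  -- Sending one generator `x ≠ x₀` to `⊤` and all others to `⊥` separates its principal congruence
  -- from every other one in the family.
  have hinj : Function.Injective fun x : X => (LatticeCon.theta (ι x₀) (ι x) : Conc F) := by
    have key : ∀ x y : X, x ≠ y → x ≠ x₀ →
        (LatticeCon.theta (ι x₀) (ι x) : Conc F) ≠ LatticeCon.theta (ι x₀) (ι y) := by
      intro x y hne' hx₀ heq
      let g := h.hom hL fun m => if m = x then (⊤ : L) else ⊥
      have h1 : (LatticeCon.theta (ι x₀) (ι y)).1 ≤ LatticeCon.ker g := by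
        rw [LatticeCon.theta_le_ker, h.hom_of, h.hom_of, if_neg hx₀.symm, if_neg hne'.symm]
      rw [← heq, LatticeCon.theta_le_ker, h.hom_of, h.hom_of, if_neg hx₀.symm, if_pos rfl] at h1
      exact hne h1
    intro x y hxy
    by_contra hne'
    by_cases hx : x = x₀
    · exact key y x (Ne.symm hne') (fun hy => hne' (hx.trans hy.symm)) hxy.symm
    · exact key x y hne' hx hxy
  have hF : #F ≤ #X := by
    refine Lattice.mk_le_of_induction (S := Set.range ι ∪ (C₀ ∪ C₁)) hX ?_ fun p hp hsup hinf =>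
      h.induction p (fun x => hp _ (Or.inl ⟨x, rfl⟩)) (fun c hc => hp _ (Or.inr (Or.inl hc)))
        (fun c hc => hp _ (Or.inr (Or.inr hc))) hsup hinf
    exact (Cardinal.mk_union_le _ _).trans (Cardinal.add_le_of_le hX Cardinal.mk_range_le
      ((h₀.union h₁).le_aleph0.trans hX))
  have hι : Function.Injective ι := fun x y hxy => hinj (by simp only [hxy])
  have : Infinite F := Infinite.of_injective ι hι
  refine le_antisymm ?_ (Cardinal.mk_le_of_injective hinj)
  have hsurj : Function.Surjective fun t : Finset (F × F) =>
      (t.sup fun p => LatticeCon.theta p.1 p.2 : Conc F) := fun c =>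
    ((LatticeCon.isRelRep F).exists_eq_sup_dist c).imp fun _ ht => ht.symm
  refine (Cardinal.mk_le_of_surjective hsurj).trans ?_
  rw [Cardinal.mk_finset_of_infinite, ← Cardinal.mul_def]
  exact (mul_le_mul' hF hF).trans (Cardinal.mul_eq_self hX).le

/-! ### Assembly of the theorem -/

theorem LatticeVariety.exists_isFreeOver {V : LatticeVariety} {X F : Type u} [Lattice F]
    {ι : X → F} (h : V.IsFree ι ∨ V.IsFreeBounded ι) :
    ∃ C₀ C₁ : Set F, C₀.Countable ∧ C₁.Countable ∧ V.IsFreeOver ι C₀ C₁ := by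
  rcases h with h | h
  · exact ⟨∅, ∅, Set.countable_empty, Set.countable_empty, h.isFreeOver⟩
  · obtain ⟨a, b, h⟩ := h.exists_isFreeOver
    exact ⟨{a}, {b}, Set.countable_singleton a, Set.countable_singleton b, h⟩

theorem corollaryC (V : LatticeVariety) (hV : V.IsNonDistributive) :
    -- every free, or free bounded, lattice `F` in `V` on at least `ℵ₂` generators
    (∀ (X F : Type u) [Lattice F] (ι : X → F), (V.IsFree ι ∨ V.IsFreeBounded ι) →
      ℵ_ 2 ≤ #X →
        -- no V-distance of type `3/2` has range join-generating `Con_c F`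
        (∀ (Y : Type v) (δ : Y → Y → Conc F),
          ¬ (IsVDistanceThreeHalves δ ∧ RangeJoinGenerates δ)) ∧
        -- `Con F` is not isomorphic to `Con 𝔸` if `𝔸` has almost permutable congruences
        (∀ (A : Type v) (𝔸 : AlgebraStructure.{v, w} A), 𝔸.HasAlmostPermutableCongruences →
          IsEmpty (LatticeCon F ≃o AlgebraCon 𝔸)) ∧
        -- `Con F` is a distributive algebraic lattice with `#X` compact elements
        IsDistribLattice (LatticeCon F) ∧
        IsCompactlyGenerated (LatticeCon F) ∧
        #(CompactElements (LatticeCon F)) = #X ∧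
        -- it is not the submodule lattice of a module
        (∀ (R : Type w) (M : Type v) [Ring R] [AddCommGroup M] [Module R M],
          IsEmpty (LatticeCon F ≃o Submodule R M)) ∧
        -- nor the normal subgroup lattice of a group
        (∀ (G : Type v) [Group G], IsEmpty (LatticeCon F ≃o {N : Subgroup G // N.Normal})) ∧
        -- nor the `ℓ`-ideal lattice of a lattice-ordered group
        (∀ (G : Type v) [Group G] [Lattice G] [MulLeftMono G] [MulRightMono G],
          IsEmpty (LatticeCon F ≃o {N : Subgroup G // IsLIdeal N}))) ∧
    -- hence the negative answer to Schmidt's problem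
    (∃ (D : Type) (_ : CompleteLattice D), IsDistribLattice D ∧ IsCompactlyGenerated D ∧
      #(CompactElements D) = ℵ_ 2 ∧
      ∀ (A : Type v) (𝔸 : AlgebraStructure.{v, w} A), 𝔸.HasAlmostPermutableCongruences →
        IsEmpty (D ≃o AlgebraCon 𝔸)) := by
  refine ⟨fun X F _ ι hι hX => ?_, ?_⟩
  · obtain ⟨C₀, C₁, h₀, h₁, h⟩ := LatticeVariety.exists_isFreeOver hι
    exact ⟨fun Y δ => h.not_isVDistanceThreeHalves hV hX δ,
      fun A 𝔸 hA => h.isEmpty_orderIso hV hX (AlgebraCon.isRelRep 𝔸) hA.isAlmostPermutable,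
      LatticeCon.isDistribLattice, (LatticeCon.isRelRep F).isCompactlyGenerated,
      h.mk_conc hV ((Cardinal.aleph0_le_aleph 2).trans hX) h₀ h₁,
      fun R M _ _ _ => h.isEmpty_orderIso hV hX (Submodule.isRelRep R M)
        (Submodule.isAlmostPermutable R M),
      fun G _ => h.isEmpty_orderIso hV hX (normalSubgroup_isRelRep G)
        (normalSubgroup_isAlmostPermutable G),
      fun G _ _ _ _ => h.isEmpty_orderIso hV hX (lIdeal_isRelRep G) (lIdeal_isAlmostPermutable G)⟩
  · obtain ⟨F, _, ι, hι⟩ := V.exists_isFree (ℵ_ 2 : Cardinal.{0}).out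
    have hX : #(ℵ_ 2 : Cardinal.{0}).out = ℵ_ 2 := Cardinal.mk_out _
    have h := hι.isFreeOver
    exact ⟨LatticeCon F, inferInstance, LatticeCon.isDistribLattice,
      (LatticeCon.isRelRep F).isCompactlyGenerated,
      (h.mk_conc hV ((Cardinal.aleph0_le_aleph 2).trans hX.ge) Set.countable_empty
        Set.countable_empty).trans hX,
      fun A 𝔸 hA => h.isEmpty_orderIso hV hX.ge (AlgebraCon.isRelRep 𝔸) hA.isAlmostPermutable⟩
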